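/- Let $\mathcal P$ be a countable set with a map $N:\mathcal P\to\mathbb Z_{>1}$, let $\mathcal M$ be the free abelian monoid generated by $\mathcal P$, and for $\mathfrak m=\sum_{\mathfrak p} n_{\mathfrak p}(\mathfrak m)\,\mathfrak p\in\mathcal M$ put $N(\mathfrak m)=\prod_{\mathfrak p}N(\mathfrak p)^{n_{\mathfrak p}(\mathfrak m)}$. Let $X\subseteq\mathbb Q$ contain $N(\mathcal M)$ and be closed under quotients: $x_1/x_2\in X$ whenever $x_1,x_2\in X$ and $x_2\neq 0$ (for example $X=\mathbb Q$, or $X=\{q^z: z\in\mathbb Z\}$ for an integer $q\ge 2$ of which all norms are powers). Assume that for some $\kappa>0$ and $0\le\theta<1$, $$(\star)\qquad |\{\mathfrak m\in\mathcal M: N(\mathfrak m)\le x\}|=\kappa x+O(x^\theta)\quad\text{for all sufficiently large } x\in X.$$ Let $\omega(\mathfrak m)=|\{\mathfrak p\in\mathcal P: n_{\mathfrak p}(\mathfrak m)\ge 1\}|$. For an integer $h\ge 2$, call $\mathfrak m$ $h$-free if $n_{\mathfrak p}(\mathfrak m)\le h-1$ for every $\mathfrak p\in\mathcal P$, and let $\mathcal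 S_h(x)$ be the set of $h$-free $\mathfrak m\in\mathcal M$ with $N(\mathfrak m)\le x$. Then for every integer $h\ge2$ and every $a\in\mathbb R$, $$\lim_{\substack{x\to\infty\\ x\in X}}\frac{1}{|\mathcal S_h(x)|}\left|\left\{\mathfrak m\in\mathcal S_h(x):\ N(\mathfrak m)\ge 3,\ \frac{\omega(\mathfrak m)-\log\log N(\mathfrak m)}{\sqrt{\log\log N(\mathfrak m)}}\le a\right\}\right|=\Phi(a),\qquad \Phi(a)=\frac1{\sqrt{2\pi}}\int_{-\infty}^a e^{-u^2/2}\,du.$$ -/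

import Mathlib

noncomputable section

namespace ErdosKacMonoid

/-- The free abelian monoid generated by the set `P`, written additively: an element is
`m = ∑ n_p(m) p`, and `m p` is the multiplicity `n_p(m)`. -/
abbrev FreeMon (P : Type*) : Type _ := P →₀ ℕ

/-- The multiplicative extension to the monoid of a norm map on the generators:
`N(m) = ∏ N(p) ^ n_p(m)`. -/
def normMap {P : Type*} (N : P → ℕ) (m : FreeMon P) : ℕ := m.prod fun p k => N p ^ k

/-- The number of generators that occur in `m`, counted without multiplicity. -/
def omega {P : Type*} (m : FreeMon P) : ℕ := m.support.card

/-- `m` is `h`-free: every generator that occurs in `m` has multiplicity at most `h - 1`. -/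
def IsFree {P : Type*} (h : ℕ) (m : FreeMon P) : Prop := ∀ p ∈ m.support, m p < h

/-- The elements of the monoid of norm at most `x`. -/
def elems {P : Type*} (N : P → ℕ) (x : ℚ) : Set (FreeMon P) := {m | (normMap N m : ℚ) ≤ x}

/-- The `h`-free elements of norm at most `x`. -/
def freeElems {P : Type*} (N : P → ℕ) (h : ℕ) (x : ℚ) : Set (FreeMon P) :=
  {m | IsFree h m ∧ (normMap N m : ℚ) ≤ x}

/-- `x → ∞` with `x` restricted to `X`. -/
def atTopIn (X : Set ℚ) : Filter ℚ := Filter.atTop ⊓ Filter.principal X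

/-- The condition on the range `X` of the counting variable: it contains every norm, and it is
closed under quotients. Both `ℚ` and `{q ^ z | z ∈ ℤ}` (when all norms are powers of `q`)
satisfy it. -/
structure IsRange {P : Type*} (N : P → ℕ) (X : Set ℚ) : Prop where
  norm_mem : ∀ m : FreeMon P, (normMap N m : ℚ) ∈ X
  div_mem : ∀ x₁ ∈ X, ∀ x₂ ∈ X, x₂ ≠ 0 → x₁ / x₂ ∈ X

/-- The number of elements of norm at most `x` is `κ x + O(x ^ θ)`, for large `x ∈ X`, for some
`κ > 0` and `0 ≤ θ < 1`. The value `0` of `Set.ncard` at infinite sets does no harm: as `κ > 0`,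
the estimate itself forces the counted sets to be finite. -/
def StarCondition {P : Type*} (N : P → ℕ) (X : Set ℚ) : Prop :=
  ∃ κ θ : ℝ, 0 < κ ∧ 0 ≤ θ ∧ θ < 1 ∧
    (fun x : ℚ => ((elems N x).ncard : ℝ) - κ * (x : ℝ)) =O[atTopIn X]
      (fun x : ℚ => (x : ℝ) ^ θ)

/-- The standard Gaussian distribution function. -/
def Phi (a : ℝ) : ℝ :=
  1 / Real.sqrt (2 * Real.pi) * ∫ u in Set.Iic a, Real.exp (-u ^ 2 / 2)

end ErdosKacMonoid

end

/-! The proof is by characteristic functions. Write u = log log x. The core,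
`LinearGrowth.tendsto_charFun_normBall`, is that x⁻¹ ∑ exp(it(ω(m) - u)/√u), over all m of norm at
most x, tends to κ exp(-t²/2). Put τ = t/√u and z = exp(iτ) - 1, and discard from ω the generators
of norm above y = exp(log x / (log log x)²). By Mertens' estimate
(`LinearGrowth.exists_abs_recipSum_sub_le`) this costs O(log log log x) = o(√u) on average. Expand
(1 + z)^ω as a sum of z^|D| over sets D of occurring generators and count the multiples of each D by
(⋆). The main term κ ∏ (1 + z/N(p)) is close to κ exp(zS), where S = ∑ 1/N(p) over N(p) ≤ y is u +
o(√u); hence exp(zS - iτu) → exp(-t²/2).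

The errors in (⋆) are summed only over D of norm at most y^ℓ with ℓ = log log x. There are x^{o(1)}
of these, each costing O(x^θ). Every other D has at least ℓ elements, and Rankin's factor 2^(|D| -
ℓ) makes their total negligible (`LinearGrowth.norm_sum_one_add_pow_omegaUpTo_sub_le`).

For h-free elements, inclusion-exclusion over the elements hD gives an alternating series of such
sums at the levels x/N(hD). For fixed D the limit only acquires the factor 1/N(hD): log log moves by
O(1), and ω by at most |D|. Closure of X under quotients keeps these levels in X. As h ≥ 2, the
series is dominated, and its limit is κ exp(-t²/2) ∏ (1 - N(p)^(-h)), with a nonzero product.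
Dividing by the case t = 0 and applying Lévy's continuity theorem gives the normal law centred at
log log x. Finally log log x is replaced by log log N(m): this moves the threshold by O(1) when N(m)
≥ √x, and the other m are O(√x) in number. -/

noncomputable section
namespace ErdosKacMonoid
open Finset

/-! ### Norms, multiples and balls -/

section Basic

variable {P : Type*} {N : P → ℕ}

lemma normMap_zero : normMap N (0 : FreeMon P) = 1 := by simp [normMap]

lemma normMap_add (m n : FreeMon P) : normMap N (m + n) = normMap N m * normMap N n := by
  classical
  exact Finsupp.prod_add_index' (fun _ => pow_zero _) (fun _ _ _ => pow_add _ _ _)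

lemma normMap_single (p : P) (k : ℕ) : normMap N (Finsupp.single p k) = N p ^ k := by
  simp [normMap]

lemma normMap_pos (hN : ∀ p, 1 < N p) (m : FreeMon P) : 0 < normMap N m :=
  Finset.prod_pos fun p _ => pow_pos (zero_lt_one.trans (hN p)) _

lemma one_le_normMap (hN : ∀ p, 1 < N p) (m : FreeMon P) : (1 : ℝ) ≤ normMap N m := by
  exact_mod_cast normMap_pos hN m

lemma log_normMap (hN : ∀ p, 1 < N p) (m : FreeMon P) :
    Real.log (normMap N m) = ∑ p ∈ m.support, m p * Real.log (N p) := by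
  rw [normMap, Finsupp.prod, Nat.cast_prod, Real.log_prod]
  · simp
  · intro p _
    have := hN p
    positivity

/-- The element `∑_{p ∈ D} k p`. -/
def multElem (k : ℕ) (D : Finset P) : FreeMon P := Finsupp.indicator D fun _ _ => k

lemma multElem_apply_of_mem {k : ℕ} {D : Finset P} {p : P} (hp : p ∈ D) : multElem k D p = k :=
  Finsupp.indicator_of_mem hp _

lemma multElem_apply_of_notMem {k : ℕ} {D : Finset P} {p : P} (hp : p ∉ D) : multElem k D p = 0 :=
  Finsupp.indicator_of_notMem hp _

lemma normMap_multElem (k : ℕ) (D : Finset P) : normMap N (multElem k D) = ∏ p ∈ D, N p ^ k := by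
  rw [normMap, Finsupp.prod_of_support_subset (s := D)]
  · exact prod_congr rfl fun p hp => by rw [multElem_apply_of_mem hp]
  · exact Finsupp.support_indicator_subset D _
  · simp

lemma multElem_injective {k : ℕ} (hk : k ≠ 0) :
    Function.Injective (multElem k : Finset P → FreeMon P) := by
  intro D E h
  ext p
  have := DFunLike.congr_fun h p
  clear h
  by_cases h1 : p ∈ D <;> by_cases h2 : p ∈ E <;>
    simp_all [multElem_apply_of_mem, multElem_apply_of_notMem]

lemma multElem_le_iff {k : ℕ} {D : Finset P} {m : FreeMon P} :
    multElem k D ≤ m ↔ ∀ p ∈ D, k ≤ m p := by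
  constructor
  · intro h p hp
    simpa [multElem_apply_of_mem hp] using h p
  · intro h p
    by_cases hp : p ∈ D
    · simpa [multElem_apply_of_mem hp] using h p hp
    · simp [multElem_apply_of_notMem hp]

lemma multElem_one_le_iff {D : Finset P} {m : FreeMon P} :
    multElem 1 D ≤ m ↔ D ⊆ m.support := by
  rw [multElem_le_iff]
  refine forall₂_congr fun p _ => ?_
  rw [Finsupp.mem_support_iff]
  omega

open Classical in
/-- The finite set of the elements of norm at most `t`, if there are finitely many. -/
def normBall (N : P → ℕ) (t : ℝ) : Finset (FreeMon P) :=
  if h : {m : FreeMon P | (normMap N m : ℝ) ≤ t}.Finite then h.toFinset else ∅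

/-- There are finitely many elements of any bounded norm, and `c t ≤ #{N(m) ≤ t} ≤ C t`. -/
structure LinearGrowth (N : P → ℕ) (c C : ℝ) : Prop where
  one_lt : ∀ p, 1 < N p
  pos : 0 < c
  finite : ∀ t : ℝ, {m : FreeMon P | (normMap N m : ℝ) ≤ t}.Finite
  le_card : ∀ t : ℝ, 1 ≤ t → c * t ≤ #(normBall N t)
  card_le : ∀ t : ℝ, 0 ≤ t → #(normBall N t) ≤ C * t

lemma mem_normBall_of_finite (hf : ∀ t : ℝ, {m : FreeMon P | (normMap N m : ℝ) ≤ t}.Finite)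
    {t : ℝ} {m : FreeMon P} : m ∈ normBall N t ↔ (normMap N m : ℝ) ≤ t := by
  rw [normBall, dif_pos (hf t)]
  simp

/-- The multiples of `d` are the translates `d + n`, and the norm is multiplicative. All later
counts of multiples rest on this. -/
lemma sum_normBall_filter_le (hN : ∀ p, 1 < N p)
    (hf : ∀ t : ℝ, {m : FreeMon P | (normMap N m : ℝ) ≤ t}.Finite)
    {M : Type*} [AddCommMonoid M] (F : FreeMon P → M) (d : FreeMon P) (t : ℝ)
    [DecidablePred fun m => d ≤ m] :
    ∑ m ∈ normBall N t with d ≤ m, F m = ∑ n ∈ normBall N (t / normMap N d), F (d + n) := by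
  have hd : (0 : ℝ) < normMap N d := by exact_mod_cast normMap_pos hN d
  refine sum_nbij' (fun m => m - d) (fun n => d + n) ?_ ?_ ?_ ?_ ?_
  · intro m hm
    obtain ⟨h1, h2⟩ := mem_filter.1 hm
    rw [mem_normBall_of_finite hf] at h1 ⊢
    rw [le_div_iff₀ hd]
    rw [← tsub_add_cancel_of_le h2, normMap_add, Nat.cast_mul] at h1
    exact h1
  · intro n hn
    rw [mem_normBall_of_finite hf, le_div_iff₀ hd] at hn
    rw [mem_filter, mem_normBall_of_finite hf, normMap_add, Nat.cast_mul, mul_comm]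
    exact ⟨hn, le_self_add⟩
  · intro m hm
    exact add_tsub_cancel_of_le (mem_filter.1 hm).2
  · intro n _
    simp
  · intro m hm
    rw [add_tsub_cancel_of_le (mem_filter.1 hm).2]

/-- The number of generators of norm at most `y` that occur in `m`. -/
def omegaUpTo (N : P → ℕ) (y : ℝ) (m : FreeMon P) : ℕ :=
  #{p ∈ m.support | (N p : ℝ) ≤ y}

namespace LinearGrowth

variable {c C : ℝ}

lemma mem_normBall (hG : LinearGrowth N c C) {t : ℝ} {m : FreeMon P} :
    m ∈ normBall N t ↔ (normMap N m : ℝ) ≤ t := mem_normBall_of_finite hG.finite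

lemma cast_pos (hG : LinearGrowth N c C) (p : P) : (0 : ℝ) < N p := by
  exact_mod_cast zero_lt_one.trans (hG.one_lt p)

lemma one_lt_cast (hG : LinearGrowth N c C) (p : P) : (1 : ℝ) < N p := by
  exact_mod_cast hG.one_lt p

lemma finite_gens (hG : LinearGrowth N c C) (t : ℝ) : {p : P | (N p : ℝ) ≤ t}.Finite := by
  refine Set.Finite.of_finite_image (f := fun p => (Finsupp.single p 1 : FreeMon P))
    ((hG.finite t).subset ?_) ?_
  · rintro _ ⟨p, hp, rfl⟩
    simpa [normMap_single] using hp
  · intro p _ q _ h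
    exact Finsupp.single_left_injective one_ne_zero h

/-- The generators of norm at most `t`. -/
def gens (hG : LinearGrowth N c C) (t : ℝ) : Finset P := (hG.finite_gens t).toFinset

lemma mem_gens (hG : LinearGrowth N c C) {t : ℝ} {p : P} : p ∈ hG.gens t ↔ (N p : ℝ) ≤ t := by
  simp [gens]

lemma gens_mono (hG : LinearGrowth N c C) {s t : ℝ} (h : s ≤ t) : hG.gens s ⊆ hG.gens t :=
  fun _ hp => hG.mem_gens.2 ((hG.mem_gens.1 hp).trans h)

lemma le_normMap_of_mem_support (hG : LinearGrowth N c C) {m : FreeMon P} {p : P}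
    (hp : p ∈ m.support) : N p ≤ normMap N m := by
  have h : Finsupp.single p 1 ≤ m := by
    rw [Finsupp.single_le_iff]
    exact Nat.one_le_iff_ne_zero.2 (Finsupp.mem_support_iff.1 hp)
  rw [← add_tsub_cancel_of_le h, normMap_add, normMap_single, pow_one]
  exact Nat.le_mul_of_pos_right _ (normMap_pos hG.one_lt _)

lemma support_subset_gens (hG : LinearGrowth N c C) {t : ℝ} {m : FreeMon P}
    (hm : m ∈ normBall N t) : m.support ⊆ hG.gens t := fun p hp => by
  rw [hG.mem_gens]
  exact le_trans (by exact_mod_cast hG.le_normMap_of_mem_support hp) (hG.mem_normBall.1 hm)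

lemma c_le_C (hG : LinearGrowth N c C) : c ≤ C := by
  simpa using (hG.le_card 1 le_rfl).trans (hG.card_le 1 zero_le_one)

lemma C_pos (hG : LinearGrowth N c C) : 0 < C := hG.pos.trans_le hG.c_le_C

/-- The sum `∑_{N(p) ≤ x} 1 / N(p)`. -/
def recipSum (hG : LinearGrowth N c C) (x : ℝ) : ℝ := ∑ p ∈ hG.gens x, (N p : ℝ)⁻¹

end LinearGrowth
end Basic
end ErdosKacMonoid
end

/-! ### Mertens' estimate for the generators, from linear growth alone -/

noncomputable section
namespace ErdosKacMonoid
open Finset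

lemma cast_harmonic_succ (n : ℕ) :
    ((harmonic (n + 1) : ℚ) : ℝ) = 1 + ∑ k ∈ Icc 1 n, ((k + 1 : ℕ) : ℝ)⁻¹ := by
  induction n with
  | zero => simp
  | succ n ih =>
    rw [harmonic_succ, sum_Icc_succ_top (by omega), Rat.cast_add, ih]
    push_cast
    ring

namespace LinearGrowth
variable {P : Type*} {N : P → ℕ} {c C : ℝ}

/-- Dyadic blocks: at most C 2^(j+1) elements have norm in [2^j, 2^(j+1)), which leaves a geometric
series of ratio 2^(-δ). -/
lemma sum_rpow_le (hG : LinearGrowth N c C) {δ : ℝ} (h0 : 0 < δ) (h1 : δ ≤ 1)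
    (F : Finset (FreeMon P)) : ∑ m ∈ F, (normMap N m : ℝ) ^ (-(1 + δ)) ≤ 4 * C / δ := by
  classical
  set J := F.image fun m => Nat.log 2 (normMap N m)
  set r : ℝ := (2 : ℝ) ^ (-δ) with hr
  have hr0 : 0 < r := by positivity
  have hr1 : r ≤ 1 - δ / 2 := by
    -- Bernoulli's inequality for the exponent δ ≤ 1: (1 - 1/2)^δ ≤ 1 - δ/2.
    have := rpow_one_add_le_one_add_mul_self (s := (-(1 / 2) : ℝ)) (by norm_num) h0.le h1
    rw [hr, Real.rpow_neg (by norm_num), ← Real.inv_rpow (by norm_num)]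
    norm_num at this ⊢
    linarith
  have hfib : ∀ j ∈ J, ∑ m ∈ F with Nat.log 2 (normMap N m) = j,
      (normMap N m : ℝ) ^ (-(1 + δ)) ≤ 2 * C * r ^ j := by
    intro j _
    have hterm : ∀ m ∈ F.filter (fun m => Nat.log 2 (normMap N m) = j),
        (normMap N m : ℝ) ^ (-(1 + δ)) ≤ ((2 : ℝ) ^ j) ^ (-(1 + δ)) := by
      intro m hm
      have h2 : 2 ^ j ≤ normMap N m := by
        rw [← (mem_filter.1 hm).2]
        exact Nat.pow_log_le_self 2 (normMap_pos hG.one_lt m).ne'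
      refine Real.rpow_le_rpow_of_nonpos (by positivity) (by exact_mod_cast h2) (by linarith)
    have hcard : (#(F.filter (fun m => Nat.log 2 (normMap N m) = j)) : ℝ) ≤ C * 2 ^ (j + 1) := by
      refine le_trans ?_ (hG.card_le _ (by positivity))
      refine Nat.cast_le.2 (card_le_card fun m hm => ?_)
      rw [hG.mem_normBall]
      have := Nat.lt_pow_succ_log_self (one_lt_two) (normMap N m)
      rw [(mem_filter.1 hm).2] at this
      exact_mod_cast this.le
    calc _ ≤ #(F.filter (fun m => Nat.log 2 (normMap N m) = j)) • ((2 : ℝ) ^ j) ^ (-(1 + δ)) :=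
          sum_le_card_nsmul _ _ _ hterm
      _ ≤ C * 2 ^ (j + 1) * ((2 : ℝ) ^ j) ^ (-(1 + δ)) := by
          rw [nsmul_eq_mul]
          gcongr
      _ = 2 * C * r ^ j := by
          rw [hr, ← Real.rpow_natCast, ← Real.rpow_natCast, ← Real.rpow_natCast,
            ← Real.rpow_mul (by norm_num), ← Real.rpow_mul (by norm_num), mul_assoc,
            ← Real.rpow_add (by norm_num),
            show ((j + 1 : ℕ) : ℝ) + j * (-(1 + δ)) = 1 + (-δ) * j by push_cast; ring,
            Real.rpow_add (by norm_num), Real.rpow_one]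
          ring
  have hr1' : r < 1 := by linarith
  calc _ = ∑ j ∈ J, ∑ m ∈ F with Nat.log 2 (normMap N m) = j, (normMap N m : ℝ) ^ (-(1 + δ)) :=
        (sum_fiberwise_of_maps_to (fun m hm => mem_image_of_mem _ hm) _).symm
    _ ≤ ∑ j ∈ J, 2 * C * r ^ j := sum_le_sum hfib
    _ = 2 * C * ∑ j ∈ J, r ^ j := (mul_sum _ _ _).symm
    _ ≤ 2 * C * (1 - r)⁻¹ := by
        have := hG.C_pos
        gcongr
        rw [← tsum_geometric_of_lt_one hr0.le hr1']
        exact (summable_geometric_of_lt_one hr0.le hr1').sum_le_tsum _ fun _ _ => by positivity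
    _ ≤ 2 * C * (δ / 2)⁻¹ := by
        have := hG.C_pos
        gcongr
        linarith
    _ = 4 * C / δ := by
        field_simp
        ring

lemma sum_inv_sq_le (hG : LinearGrowth N c C) (F : Finset (FreeMon P)) :
    ∑ m ∈ F, ((normMap N m : ℝ) ^ 2)⁻¹ ≤ 4 * C := by
  have := hG.sum_rpow_le one_pos le_rfl F
  rw [div_one] at this
  refine le_trans (le_of_eq (sum_congr rfl fun m _ => ?_)) this
  rw [Real.rpow_neg (by positivity)]
  norm_num

lemma sum_multElem_rpow_le (hG : LinearGrowth N c C) {δ : ℝ} (h0 : 0 < δ) (h1 : δ ≤ 1)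
    (F : Finset (Finset P)) : ∑ D ∈ F, ∏ p ∈ D, (N p : ℝ) ^ (-(1 + δ)) ≤ 4 * C / δ := by
  classical
  refine le_trans (le_of_eq ?_) (hG.sum_rpow_le h0 h1 (F.image (multElem 1)))
  rw [sum_image fun D _ E _ h => multElem_injective one_ne_zero h]
  refine sum_congr rfl fun D _ => ?_
  rw [normMap_multElem, Nat.cast_prod, ← Real.finsetProd_rpow _ _ fun _ _ => by positivity]
  simp

lemma sum_gen_inv_sq_le (hG : LinearGrowth N c C) (Q : Finset P) :
    ∑ p ∈ Q, ((N p : ℝ) ^ 2)⁻¹ ≤ 4 * C := by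
  classical
  refine le_trans (le_of_eq ?_) (hG.sum_inv_sq_le (Q.image fun p => Finsupp.single p 1))
  rw [sum_image fun D _ E _ h => Finsupp.single_left_injective one_ne_zero h]
  simp [normMap_single]

lemma summable_gen_inv_sq (hG : LinearGrowth N c C) : Summable fun p => ((N p : ℝ) ^ 2)⁻¹ :=
  summable_of_sum_le (fun _ => by positivity) hG.sum_gen_inv_sq_le

/-- Abel summation: 1/N(m) is at least the telescoping sum of 1/k - 1/(k+1) over N(m) ≤ k ≤ x.
Exchanging sums and using that at least ck elements have norm ≤ k leaves c ∑ 1/(k+1). -/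
lemma log_le_sum_inv (hG : LinearGrowth N c C) {x : ℝ} (hx : 0 < x) :
    c * (Real.log x - 1) ≤ ∑ m ∈ normBall N x, (normMap N m : ℝ)⁻¹ := by
  set n := ⌊x⌋₊ with hn
  have hterm : ∀ m ∈ normBall N x,
      ∑ k ∈ Icc 1 n with normMap N m ≤ k, ((k : ℝ)⁻¹ - ((k + 1 : ℕ) : ℝ)⁻¹) ≤
        (normMap N m : ℝ)⁻¹ := by
    intro m hm
    have hmn : normMap N m ≤ n := Nat.le_floor (hG.mem_normBall.1 hm)
    have h1 := normMap_pos hG.one_lt m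
    have : (Icc 1 n).filter (fun k => normMap N m ≤ k) = Ico (normMap N m) (n + 1) := by
      ext k
      simp only [mem_filter, mem_Icc, mem_Ico]
      omega
    rw [this, sum_Ico_eq_sub _ (by omega), sum_range_sub', sum_range_sub']
    have : (0 : ℝ) ≤ ((n + 1 : ℕ) : ℝ)⁻¹ := by positivity
    linarith
  calc c * (Real.log x - 1) ≤ c * ∑ k ∈ Icc 1 n, ((k + 1 : ℕ) : ℝ)⁻¹ := by
        have := hG.pos
        gcongr
        have h1 := log_add_one_le_harmonic (n + 1)
        have h2 : Real.log x ≤ Real.log ((n + 1 : ℕ) + 1 : ℝ) := by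
          refine Real.log_le_log hx ?_
          have := Nat.lt_floor_add_one x
          push_cast
          linarith
        have h3 : ((harmonic (n + 1) : ℚ) : ℝ) = 1 + ∑ k ∈ Icc 1 n, ((k + 1 : ℕ) : ℝ)⁻¹ := by
          rw [cast_harmonic_succ]
        push_cast at h1 h2
        linarith
    _ ≤ ∑ k ∈ Icc 1 n, #(normBall N k) * ((k : ℝ)⁻¹ - ((k + 1 : ℕ) : ℝ)⁻¹) := by
        rw [mul_sum]
        refine sum_le_sum fun k hk => ?_
        have hk1 : 1 ≤ k := (mem_Icc.1 hk).1
        have hk' : (1 : ℝ) ≤ k := by exact_mod_cast hk1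
        have e : (k : ℝ)⁻¹ - ((k + 1 : ℕ) : ℝ)⁻¹ = (k : ℝ)⁻¹ * ((k + 1 : ℕ) : ℝ)⁻¹ := by
          push_cast
          field_simp
          ring
        rw [e]
        calc c * ((k + 1 : ℕ) : ℝ)⁻¹ = (c * k) * ((k : ℝ)⁻¹ * ((k + 1 : ℕ) : ℝ)⁻¹) := by
              field_simp
          _ ≤ _ := by
              gcongr
              exact hG.le_card k hk'
    _ = ∑ m ∈ normBall N x, ∑ k ∈ Icc 1 n with normMap N m ≤ k,
          ((k : ℝ)⁻¹ - ((k + 1 : ℕ) : ℝ)⁻¹) := by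
        simp_rw [sum_filter]
        rw [sum_comm]
        refine sum_congr rfl fun k hk => ?_
        rw [← sum_filter, sum_const, nsmul_eq_mul]
        congr 3
        ext m
        have : (k : ℝ) ≤ x := (Nat.le_floor_iff hx.le).1 (mem_Icc.1 hk).2
        simp only [mem_filter, hG.mem_normBall, Nat.cast_le]
        exact ⟨fun h => ⟨le_trans (by exact_mod_cast h) this, h⟩, fun h => h.2⟩
    _ ≤ _ := sum_le_sum hterm

/-- Each m is uniquely a squarefree element plus twice another one, by the parities of the
multiplicities. The squarefree parts give the product, the doubled parts a convergent sum of inverse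
squares. -/
lemma sum_inv_le_mul_prod (hG : LinearGrowth N c C) (x : ℝ) :
    ∑ m ∈ normBall N x, (normMap N m : ℝ)⁻¹ ≤
      (∏ p ∈ hG.gens x, (1 + (N p : ℝ)⁻¹)) * (4 * C) := by
  classical
  set half : FreeMon P → FreeMon P := fun m => m.mapRange (· / 2) (by simp) with hhalf
  set odd : FreeMon P → Finset P := fun m => {p ∈ m.support | m p % 2 = 1} with hodd
  have key : ∀ m, multElem 1 (odd m) + half m + half m = m := by
    intro m
    ext p
    by_cases hp : p ∈ odd m
    · have := (mem_filter.1 hp).2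
      simp only [Finsupp.add_apply, multElem_apply_of_mem hp, hhalf, Finsupp.mapRange_apply]
      omega
    · have : ¬ m p % 2 = 1 := fun h => hp <| mem_filter.2
        ⟨Finsupp.mem_support_iff.2 (by omega), h⟩
      simp only [Finsupp.add_apply, multElem_apply_of_notMem hp, hhalf, Finsupp.mapRange_apply]
      omega
  have hinj : Function.Injective fun m => (odd m, half m) := by
    intro m n h
    obtain ⟨h1, h2⟩ := Prod.mk.inj h
    rw [← key m, ← key n, h1, h2]
  have hval : ∀ m, (normMap N m : ℝ)⁻¹ =
      (∏ p ∈ odd m, (N p : ℝ)⁻¹) * ((normMap N (half m) : ℝ) ^ 2)⁻¹ := by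
    intro m
    conv_lhs => rw [← key m]
    rw [normMap_add, normMap_add, normMap_multElem]
    push_cast
    simp only [pow_one, prod_inv_distrib]
    rw [← mul_inv]
    ring
  calc ∑ m ∈ normBall N x, (normMap N m : ℝ)⁻¹
      = ∑ q ∈ (normBall N x).image fun m => (odd m, half m),
          (∏ p ∈ q.1, (N p : ℝ)⁻¹) * ((normMap N q.2 : ℝ) ^ 2)⁻¹ := by
        rw [sum_image fun _ _ _ _ h => hinj h]
        exact sum_congr rfl fun m _ => hval m
    _ ≤ ∑ q ∈ (hG.gens x).powerset ×ˢ (normBall N x).image half,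
          (∏ p ∈ q.1, (N p : ℝ)⁻¹) * ((normMap N q.2 : ℝ) ^ 2)⁻¹ := by
        refine sum_le_sum_of_subset_of_nonneg ?_ fun _ _ _ => by positivity
        intro q hq
        obtain ⟨m, hm, rfl⟩ := mem_image.1 hq
        exact mem_product.2 ⟨mem_powerset.2 ((filter_subset _ _).trans (hG.support_subset_gens hm)),
          mem_image_of_mem _ hm⟩
    _ = (∏ p ∈ hG.gens x, (1 + (N p : ℝ)⁻¹)) *
          ∑ n ∈ (normBall N x).image half, ((normMap N n : ℝ) ^ 2)⁻¹ := by
        rw [prod_one_add, sum_mul_sum, sum_product]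
    _ ≤ _ := by
        have := hG.sum_inv_sq_le ((normBall N x).image half)
        gcongr

lemma recipSum_nonneg (hG : LinearGrowth N c C) (x : ℝ) : 0 ≤ hG.recipSum x :=
  sum_nonneg fun _ _ => by positivity

lemma recipSum_mono (hG : LinearGrowth N c C) {x y : ℝ} (h : x ≤ y) :
    hG.recipSum x ≤ hG.recipSum y :=
  sum_le_sum_of_subset_of_nonneg (hG.gens_mono h) fun _ _ _ => by positivity

lemma exists_le_recipSum (hG : LinearGrowth N c C) :
    ∃ B : ℝ, ∀ x : ℝ, Real.exp 2 ≤ x → Real.log (Real.log x) - B ≤ hG.recipSum x := by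
  have hc := hG.pos
  have hC := hG.C_pos
  refine ⟨Real.log (8 * C / c), fun x hx => ?_⟩
  have hx0 : 0 < x := (Real.exp_pos _).trans_le hx
  have hl : 2 ≤ Real.log x := (Real.le_log_iff_exp_le hx0).2 hx
  have h1 := (hG.log_le_sum_inv hx0).trans (hG.sum_inv_le_mul_prod x)
  have h2 := Real.prod_one_add_le_exp_sum (hG.gens x) (f := fun p => (N p : ℝ)⁻¹)
    (fun _ => by positivity)
  have h3 : c * (Real.log x / 2) ≤ Real.exp (hG.recipSum x) * (4 * C) :=
    calc c * (Real.log x / 2) ≤ c * (Real.log x - 1) := by gcongr; linarith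
      _ ≤ _ := h1
      _ ≤ _ := by gcongr; exact h2
  have h4 : Real.log x / (8 * C / c) ≤ Real.exp (hG.recipSum x) := by
    rw [div_le_iff₀ (by positivity)]
    calc Real.log x = (c * (Real.log x / 2)) * (2 / c) := by field_simp
      _ ≤ (Real.exp (hG.recipSum x) * (4 * C)) * (2 / c) := by gcongr
      _ = _ := by field_simp; ring
  rw [← Real.log_div (by linarith) (by positivity)]
  rw [Real.log_le_iff_le_exp (by positivity)]
  exact h4

/-- Chebyshev's argument: the sum of log N(m) over the ball is at most Cx log x, while each
generator p of norm at most x contributes log N(p) for each of its at least cx/N(p) multiples. -/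
lemma sum_log_div_le (hG : LinearGrowth N c C) {x : ℝ} (hx : 1 ≤ x) :
    ∑ p ∈ hG.gens x, Real.log (N p) * (N p : ℝ)⁻¹ ≤ C / c * Real.log x := by
  classical
  have hc := hG.pos
  have hx0 : 0 < x := by linarith
  have hlow : ∑ p ∈ hG.gens x, Real.log (N p) * (c * (x / N p)) ≤
      ∑ m ∈ normBall N x, Real.log (normMap N m) := by
    calc _ ≤ ∑ p ∈ hG.gens x, ∑ m ∈ normBall N x with Finsupp.single p 1 ≤ m, Real.log (N p) := by
          refine sum_le_sum fun p hp => ?_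
          rw [sum_normBall_filter_le hG.one_lt hG.finite (fun _ => Real.log (N p)), sum_const,
            nsmul_eq_mul, mul_comm, normMap_single, pow_one]
          have h1 := hG.one_lt_cast p
          have := Real.log_pos h1
          gcongr
          refine hG.le_card _ ?_
          rw [one_le_div (hG.cast_pos p)]
          exact hG.mem_gens.1 hp
      _ = ∑ m ∈ normBall N x, ∑ p ∈ hG.gens x with Finsupp.single p 1 ≤ m, Real.log (N p) := by
          simp_rw [sum_filter]
          exact sum_comm
      _ ≤ _ := by
          refine sum_le_sum fun m hm => ?_
          rw [log_normMap hG.one_lt]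
          have hsub : (hG.gens x).filter (fun p => Finsupp.single p 1 ≤ m) ⊆ m.support := by
            intro p hp
            have := (mem_filter.1 hp).2
            rw [Finsupp.single_le_iff] at this
            exact Finsupp.mem_support_iff.2 (by omega)
          have hpos : ∀ p, 0 ≤ Real.log (N p) := fun p => (Real.log_pos (hG.one_lt_cast p)).le
          refine (sum_le_sum_of_subset_of_nonneg hsub fun p _ _ => hpos p).trans ?_
          refine sum_le_sum fun p hp => le_mul_of_one_le_left (hpos p) ?_
          exact_mod_cast Nat.one_le_iff_ne_zero.2 (Finsupp.mem_support_iff.1 hp)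
  have hup : ∑ m ∈ normBall N x, Real.log (normMap N m) ≤ C * x * Real.log x := by
    calc _ ≤ #(normBall N x) • Real.log x := by
          refine sum_le_card_nsmul _ _ _ fun m hm => ?_
          exact Real.log_le_log (by linarith [one_le_normMap hG.one_lt m]) (hG.mem_normBall.1 hm)
      _ ≤ _ := by
          rw [nsmul_eq_mul]
          have := Real.log_nonneg hx
          gcongr
          exact hG.card_le x hx0.le
  have h := hlow.trans hup
  have e : ∑ p ∈ hG.gens x, Real.log (N p) * (c * (x / N p)) =
      (c * x) * ∑ p ∈ hG.gens x, Real.log (N p) * (N p : ℝ)⁻¹ := by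
    rw [mul_sum]
    refine sum_congr rfl fun p _ => ?_
    rw [div_eq_mul_inv]
    ring
  rw [e] at h
  rw [← mul_le_mul_iff_right₀ (show 0 < c * x by positivity)]
  refine h.trans (le_of_eq ?_)
  field_simp

/-- Damp 1/N(p) to N(p)^(-1-δ) with δ = 1/log x. The Euler product of the damped terms is at most
4C/δ, so their sum is at most log log x + O(1). Undoing the damping costs at most δ ∑ log N(p)/N(p)
≤ C/c. -/
lemma exists_recipSum_le (hG : LinearGrowth N c C) :
    ∃ B : ℝ, ∀ x : ℝ, Real.exp 2 ≤ x → hG.recipSum x ≤ Real.log (Real.log x) + B := by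
  have hc := hG.pos
  have hC := hG.C_pos
  refine ⟨C / c + (Real.log (4 * C) + 4 * C), fun x hx => ?_⟩
  have hx0 : 0 < x := (Real.exp_pos _).trans_le hx
  have hl : 2 ≤ Real.log x := (Real.le_log_iff_exp_le hx0).2 hx
  have hx1 : 1 ≤ x := (Real.one_le_exp (by norm_num)).trans hx
  set δ := (Real.log x)⁻¹ with hδ
  have hδ0 : 0 < δ := by positivity
  have hδ1 : δ ≤ 1 := inv_le_one_of_one_le₀ (by linarith)
  set w : P → ℝ := fun p => (N p : ℝ) ^ (-(1 + δ)) with hw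
  have hw0 : ∀ p, 0 ≤ w p := fun p => by positivity
  have hw1 : ∀ p, w p ≤ (N p : ℝ)⁻¹ := fun p => by
    rw [← Real.rpow_neg_one]
    exact Real.rpow_le_rpow_of_exponent_le (hG.one_lt_cast p).le (by linarith)
  -- Factorwise, exp w ≤ 1 + w + w² ≤ (1 + w)(1 + N(p)⁻²).
  have hexp : Real.exp (∑ p ∈ hG.gens x, w p) ≤
      (∏ p ∈ hG.gens x, (1 + w p)) * ∏ p ∈ hG.gens x, (1 + ((N p : ℝ) ^ 2)⁻¹) := by
    rw [Real.exp_sum, ← prod_mul_distrib]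
    refine prod_le_prod (fun _ _ => (Real.exp_pos _).le) fun p _ => ?_
    have hle1 : w p ≤ 1 := (hw1 p).trans (inv_le_one_of_one_le₀ (hG.one_lt_cast p).le)
    have h1 := Real.abs_exp_sub_one_sub_id_le (x := w p) (by rw [abs_of_nonneg (hw0 p)]; exact hle1)
    have h2 := (abs_le.1 h1).2
    have h3 : w p ^ 2 ≤ ((N p : ℝ) ^ 2)⁻¹ := by
      rw [← inv_pow]
      exact pow_le_pow_left₀ (hw0 p) (hw1 p) 2
    have := hw0 p
    have h4 : 0 ≤ ((N p : ℝ) ^ 2)⁻¹ := by positivity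
    nlinarith
  have h1 : ∏ p ∈ hG.gens x, (1 + w p) ≤ 4 * C * Real.log x := by
    rw [prod_one_add]
    refine (hG.sum_multElem_rpow_le hδ0 hδ1 _).trans (le_of_eq ?_)
    rw [hδ, div_inv_eq_mul]
  have h2 : ∏ p ∈ hG.gens x, (1 + ((N p : ℝ) ^ 2)⁻¹) ≤ Real.exp (4 * C) :=
    (Real.prod_one_add_le_exp_sum _ fun _ => by positivity).trans
      (Real.exp_le_exp.2 (hG.sum_gen_inv_sq_le _))
  have h3 : ∑ p ∈ hG.gens x, w p ≤ Real.log (Real.log x) + (Real.log (4 * C) + 4 * C) := by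
    rw [← Real.exp_le_exp]
    refine hexp.trans ((mul_le_mul h1 h2 (by positivity) (by positivity)).trans (le_of_eq ?_))
    rw [Real.exp_add, Real.exp_add, Real.exp_log (by linarith), Real.exp_log (by positivity)]
    ring
  have h4 : hG.recipSum x - ∑ p ∈ hG.gens x, w p ≤ C / c := by
    rw [recipSum, ← sum_sub_distrib]
    calc _ ≤ ∑ p ∈ hG.gens x, δ * (Real.log (N p) * (N p : ℝ)⁻¹) := by
          refine sum_le_sum fun p _ => ?_
          have hp := hG.cast_pos p
          have e : w p = (N p : ℝ)⁻¹ * Real.exp (-(δ * Real.log (N p))) := by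
            rw [hw]
            simp only
            rw [neg_add, Real.rpow_add hp, Real.rpow_neg_one, Real.rpow_def_of_pos hp]
            congr 2
            ring
          have h5 := Real.add_one_le_exp (-(δ * Real.log (N p)))
          rw [e]
          have h6 : 0 < (N p : ℝ)⁻¹ := by positivity
          nlinarith
      _ ≤ δ * (C / c * Real.log x) := by
          rw [← mul_sum]
          gcongr
          exact hG.sum_log_div_le hx1
      _ = C / c := by
          rw [hδ]
          field_simp
  linarith

lemma exists_abs_recipSum_sub_le (hG : LinearGrowth N c C) :
    ∃ B : ℝ, ∀ x : ℝ, Real.exp 2 ≤ x → |hG.recipSum x - Real.log (Real.log x)| ≤ B := by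
  obtain ⟨B₁, h₁⟩ := hG.exists_le_recipSum
  obtain ⟨B₂, h₂⟩ := hG.exists_recipSum_le
  refine ⟨max B₁ B₂, fun x hx => abs_le.2 ⟨?_, ?_⟩⟩
  · linarith [h₁ x hx, le_max_left B₁ B₂]
  · linarith [h₂ x hx, le_max_right B₁ B₂]

end LinearGrowth
end ErdosKacMonoid
end

/-! ### Exponential sums with ω truncated -/

noncomputable section
namespace ErdosKacMonoid
open Finset

lemma norm_prod_sub_prod_le_of_norm_le_one {ι : Type*} (Q : Finset ι) (f g : ι → ℂ)
    (hf : ∀ i ∈ Q, ‖f i‖ ≤ 1) (hg : ∀ i ∈ Q, ‖g i‖ ≤ 1) :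
    ‖∏ i ∈ Q, f i - ∏ i ∈ Q, g i‖ ≤ ∑ i ∈ Q, ‖f i - g i‖ := by
  classical
  induction Q using Finset.induction_on with
  | empty => simp
  | insert i Q hi ih =>
    rw [prod_insert hi, prod_insert hi, sum_insert hi]
    have h1 := ih (fun j hj => hf j (mem_insert_of_mem hj)) fun j hj => hg j (mem_insert_of_mem hj)
    have h2 : ‖∏ j ∈ Q, f j‖ ≤ 1 := by
      rw [norm_prod]
      exact prod_le_one (fun _ _ => norm_nonneg _) fun j hj => hf j (mem_insert_of_mem hj)
    calc ‖f i * ∏ j ∈ Q, f j - g i * ∏ j ∈ Q, g j‖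
        = ‖(f i - g i) * ∏ j ∈ Q, f j + g i * (∏ j ∈ Q, f j - ∏ j ∈ Q, g j)‖ := by
          congr 1
          ring
      _ ≤ ‖f i - g i‖ * ‖∏ j ∈ Q, f j‖ + ‖g i‖ * ‖∏ j ∈ Q, f j - ∏ j ∈ Q, g j‖ := by
          rw [← norm_mul, ← norm_mul]
          exact norm_add_le _ _
      _ ≤ ‖f i - g i‖ * 1 + 1 * ‖∏ j ∈ Q, f j - ∏ j ∈ Q, g j‖ := by
          gcongr
          exact hg i (mem_insert_self _ _)
      _ ≤ _ := by linarith

lemma norm_exp_I_mul_sub_one_le (s : ℝ) : ‖Complex.exp (Complex.I * s) - 1‖ ≤ |s| :=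
  Real.norm_exp_I_mul_ofReal_sub_one_le

lemma norm_exp_I_mul_sub_exp_I_mul_le (s s' : ℝ) :
    ‖Complex.exp (Complex.I * s) - Complex.exp (Complex.I * s')‖ ≤ |s - s'| := by
  have : Complex.exp (Complex.I * s) - Complex.exp (Complex.I * s') =
      Complex.exp (Complex.I * s') * (Complex.exp (Complex.I * ((s - s' : ℝ) : ℂ)) - 1) := by
    rw [mul_sub, ← Complex.exp_add, mul_one]
    congr 2
    push_cast
    ring
  rw [this, norm_mul, mul_comm Complex.I, Complex.norm_exp_ofReal_mul_I, one_mul]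
  exact norm_exp_I_mul_sub_one_le _

/-- All factors on both sides lie in the unit disc, so the products differ by at most the sum of the
differences of factors, each of second order in τ b. -/
lemma norm_prod_one_add_sub_exp_le {ι : Type*} (Q : Finset ι) (b : ι → ℝ) (τ : ℝ) (hτ : |τ| ≤ 1)
    (hb0 : ∀ i ∈ Q, 0 ≤ b i) (hb1 : ∀ i ∈ Q, b i ≤ 1) :
    ‖∏ i ∈ Q, (1 + (Complex.exp (Complex.I * τ) - 1) * b i) -
      Complex.exp ((Complex.exp (Complex.I * τ) - 1) * (∑ i ∈ Q, b i : ℝ))‖ ≤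
        τ ^ 2 * ∑ i ∈ Q, b i ^ 2 := by
  set z := Complex.exp (Complex.I * τ) - 1 with hz
  have hz1 : ‖z‖ ≤ |τ| := norm_exp_I_mul_sub_one_le τ
  have hre : z.re ≤ 0 := by
    rw [hz, mul_comm, Complex.sub_re, Complex.exp_ofReal_mul_I_re, Complex.one_re]
    linarith [Real.cos_le_one τ]
  have e : Complex.exp (z * (∑ i ∈ Q, b i : ℝ)) = ∏ i ∈ Q, Complex.exp (z * b i) := by
    rw [← Complex.exp_sum, Complex.ofReal_sum, mul_sum]
  rw [e]
  refine (norm_prod_sub_prod_le_of_norm_le_one Q _ _ ?_ ?_).trans ?_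
  · intro i hi
    -- A convex combination of 1 and exp(iτ), hence of modulus at most 1.
    have h : 1 + z * b i = ((1 - b i : ℝ) : ℂ) + b i * Complex.exp (τ * Complex.I) := by
      rw [hz, mul_comm Complex.I]
      push_cast
      ring
    rw [h]
    refine (norm_add_le _ _).trans ?_
    rw [norm_mul, Complex.norm_exp_ofReal_mul_I, Complex.norm_real, Complex.norm_real,
      Real.norm_of_nonneg (hb0 i hi), Real.norm_of_nonneg (sub_nonneg.2 (hb1 i hi))]
    linarith
  · intro i hi
    rw [Complex.norm_exp, Real.exp_le_one_iff]
    have : (z * b i).re = z.re * b i := by simp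
    rw [this]
    exact mul_nonpos_of_nonpos_of_nonneg hre (hb0 i hi)
  · rw [mul_sum]
    refine sum_le_sum fun i hi => ?_
    have hn : ‖z * b i‖ ≤ |τ| * b i := by
      rw [norm_mul, Complex.norm_real, Real.norm_of_nonneg (hb0 i hi)]
      exact mul_le_mul_of_nonneg_right hz1 (hb0 i hi)
    have hn1 : ‖z * b i‖ ≤ 1 := hn.trans (mul_le_one₀ hτ (hb0 i hi) (hb1 i hi))
    have h := Complex.norm_exp_sub_one_sub_id_le hn1
    rw [norm_sub_rev]
    calc _ = ‖Complex.exp (z * b i) - 1 - z * b i‖ := by rw [sub_sub]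
      _ ≤ ‖z * b i‖ ^ 2 := h
      _ ≤ (|τ| * b i) ^ 2 := pow_le_pow_left₀ (norm_nonneg _) hn 2
      _ = _ := by rw [mul_pow, sq_abs]

lemma norm_exp_I_mul_sub_taylor_le {τ : ℝ} (hτ : |τ| ≤ 1) :
    ‖Complex.exp (Complex.I * τ) - 1 - Complex.I * τ + τ ^ 2 / 2‖ ≤ |τ| ^ 3 := by
  have hn : ‖Complex.I * (τ : ℂ)‖ = |τ| := by simp
  have h := Complex.exp_bound (x := Complex.I * τ) (by rw [hn]; exact hτ) (n := 3) (by norm_num)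
  rw [hn] at h
  have e : ∑ m ∈ range 3, (Complex.I * (τ : ℂ)) ^ m / (m.factorial : ℂ) =
      1 + Complex.I * τ - τ ^ 2 / 2 := by
    simp [sum_range_succ, mul_pow]
    ring
  rw [e] at h
  calc _ = ‖Complex.exp (Complex.I * τ) - (1 + Complex.I * τ - τ ^ 2 / 2)‖ := by
        congr 1
        ring
    _ ≤ _ := h
    _ ≤ |τ| ^ 3 * 1 := by
        gcongr
        norm_num [Nat.factorial]
    _ = _ := mul_one _

namespace LinearGrowth
variable {P : Type*} {N : P → ℕ} {c C : ℝ}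

lemma sum_one_add_pow_omegaUpTo (hG : LinearGrowth N c C) (x y : ℝ) (z : ℂ) :
    ∑ m ∈ normBall N x, (1 + z) ^ omegaUpTo N y m =
      ∑ D ∈ (hG.gens y).powerset, z ^ #D * #(normBall N (x / normMap N (multElem 1 D))) := by
  classical
  calc _ = ∑ m ∈ normBall N x, ∑ D ∈ (hG.gens y).powerset with multElem 1 D ≤ m, z ^ #D := by
        refine sum_congr rfl fun m _ => ?_
        have : (hG.gens y).powerset.filter (fun D => multElem 1 D ≤ m) =
            ({p ∈ m.support | (N p : ℝ) ≤ y}).powerset := by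
          ext D
          simp only [mem_filter, mem_powerset, multElem_one_le_iff, subset_iff, hG.mem_gens]
          exact ⟨fun h p hp => ⟨h.2 hp, h.1 hp⟩,
            fun h => ⟨fun p hp => (h hp).2, fun p hp => (h hp).1⟩⟩
        rw [this, omegaUpTo, ← prod_const, prod_one_add]
        simp
    _ = ∑ D ∈ (hG.gens y).powerset, ∑ m ∈ normBall N x with multElem 1 D ≤ m, z ^ #D := by
        simp_rw [sum_filter]
        exact sum_comm
    _ = _ := by
        refine sum_congr rfl fun D _ => ?_
        rw [sum_normBall_filter_le hG.one_lt hG.finite (fun _ => z ^ #D), sum_const, nsmul_eq_mul,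
          mul_comm]

/-- The parameter ℓ splits the sets D. If N(D) ≤ y^ℓ, the counting error is used, for at most C y^ℓ
sets. Otherwise |D| ≥ ℓ, and the trivial bound (C + κ)x/N(D) is weighted by Rankin's factor 2^(|D| -
ℓ) ≥ 1. -/
lemma norm_sum_one_add_pow_omegaUpTo_sub_le (hG : LinearGrowth N c C) {κ θ E x y ℓ : ℝ}
    (hκ : 0 ≤ κ) (hθ : 0 ≤ θ) (hE : 0 ≤ E) (hx : 0 < x) (hy : 1 ≤ y)
    (hA : ∀ d : FreeMon P, |(#(normBall N (x / normMap N d)) : ℝ) - κ * (x / normMap N d)| ≤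
      E * (x / normMap N d) ^ θ) {z : ℂ} (hz : ‖z‖ ≤ 1) :
    ‖∑ m ∈ normBall N x, (1 + z) ^ omegaUpTo N y m -
        κ * x * ∏ p ∈ hG.gens y, (1 + z * ((N p : ℝ)⁻¹ : ℝ))‖ ≤
      C * y ^ ℓ * (E * x ^ θ) + (C + κ) * x * 2 ^ (-ℓ) * Real.exp (2 * ‖z‖ * hG.recipSum y) := by
  classical
  have hC := hG.C_pos
  have hNd : ∀ d : FreeMon P, (1 : ℝ) ≤ normMap N d := one_le_normMap hG.one_lt
  have hinv : ∀ D : Finset P, ((normMap N (multElem 1 D) : ℝ))⁻¹ = ∏ p ∈ D, (N p : ℝ)⁻¹ := by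
    intro D
    rw [normMap_multElem]
    simp
  have hterm : ∀ D ∈ (hG.gens y).powerset,
      ‖z ^ #D * #(normBall N (x / normMap N (multElem 1 D))) -
        κ * x * ∏ p ∈ D, (z * ((N p : ℝ)⁻¹ : ℝ))‖ ≤
      (if (normMap N (multElem 1 D) : ℝ) ≤ y ^ ℓ then E * x ^ θ else 0) +
        (C + κ) * x * 2 ^ (-ℓ) * ∏ p ∈ D, (2 * ‖z‖ * (N p : ℝ)⁻¹) := by
    intro D hD
    set d := multElem 1 D
    have hd := hNd d
    have hxd : 0 < x / normMap N d := by positivity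
    have e1 : z ^ #D * #(normBall N (x / normMap N d)) -
        κ * x * ∏ p ∈ D, (z * ((N p : ℝ)⁻¹ : ℝ)) =
        z ^ #D * (((#(normBall N (x / normMap N d)) : ℝ) - κ * (x / normMap N d) : ℝ) : ℂ) := by
      rw [prod_mul_distrib, prod_const, ← Complex.ofReal_prod, ← hinv D, div_eq_mul_inv]
      push_cast
      ring
    rw [e1, norm_mul, norm_pow, Complex.norm_real, Real.norm_eq_abs]
    have hp1 : 0 ≤ (C + κ) * x * 2 ^ (-ℓ) * ∏ p ∈ D, (2 * ‖z‖ * (N p : ℝ)⁻¹) := by positivity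
    split_ifs with h
    · refine le_trans ?_ (le_add_of_nonneg_right hp1)
      calc _ ≤ 1 * (E * (x / normMap N d) ^ θ) := by
            gcongr
            · exact pow_le_one₀ (norm_nonneg _) hz
            · exact hA d
        _ ≤ E * x ^ θ := by
            rw [one_mul]
            gcongr
            exact div_le_self hx.le hd
    · rw [zero_add]
      have hcard : ℓ ≤ #D := by
        by_contra! hlt
        refine h ?_
        calc (normMap N d : ℝ) = ∏ p ∈ D, (N p : ℝ) := by rw [normMap_multElem]; simp
          _ ≤ ∏ p ∈ D, y := prod_le_prod (fun _ _ => by positivity) fun p hp =>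
              hG.mem_gens.1 (mem_powerset.1 hD hp)
          _ = y ^ (#D : ℝ) := by rw [prod_const, Real.rpow_natCast]
          _ ≤ y ^ ℓ := Real.rpow_le_rpow_of_exponent_le hy hlt.le
      have h2 : (1 : ℝ) ≤ 2 ^ (-ℓ) * 2 ^ #D := by
        rw [← Real.rpow_natCast, ← Real.rpow_add (by norm_num)]
        exact Real.one_le_rpow (by norm_num) (by linarith)
      calc _ ≤ ‖z‖ ^ #D * ((C + κ) * (x / normMap N d)) := by
            gcongr
            have h3 := hG.card_le _ hxd.le
            have h4 : 0 ≤ κ * (x / normMap N d) := by positivity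
            have h5 : (0 : ℝ) ≤ #(normBall N (x / normMap N d)) := by positivity
            have h6 : 0 ≤ C * (x / normMap N d) := by positivity
            rw [add_mul, abs_le]
            constructor <;> linarith
        _ = 1 * (‖z‖ ^ #D * ((C + κ) * (x * (normMap N d : ℝ)⁻¹))) := by
            rw [one_mul, div_eq_mul_inv]
        _ ≤ (2 ^ (-ℓ) * 2 ^ #D) * (‖z‖ ^ #D * ((C + κ) * (x * (normMap N d : ℝ)⁻¹))) := by
            gcongr
        _ = _ := by
            rw [prod_mul_distrib, prod_const, ← hinv D, mul_pow]
            ring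
  have e : ∑ m ∈ normBall N x, (1 + z) ^ omegaUpTo N y m -
        κ * x * ∏ p ∈ hG.gens y, (1 + z * ((N p : ℝ)⁻¹ : ℝ)) =
      ∑ D ∈ (hG.gens y).powerset, (z ^ #D * #(normBall N (x / normMap N (multElem 1 D))) -
        κ * x * ∏ p ∈ D, (z * ((N p : ℝ)⁻¹ : ℝ))) := by
    rw [hG.sum_one_add_pow_omegaUpTo, prod_one_add, mul_sum, sum_sub_distrib]
  rw [e]
  refine (norm_sum_le_of_le _ hterm).trans ?_
  rw [sum_add_distrib, ← mul_sum, ← prod_one_add, ← sum_filter, sum_const, nsmul_eq_mul]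
  gcongr
  · refine le_trans ?_ (hG.card_le _ (by positivity))
    refine Nat.cast_le.2 (card_le_card_of_injOn (multElem 1) ?_
      (multElem_injective one_ne_zero).injOn)
    intro D hD
    exact hG.mem_normBall.2 (mem_filter.1 hD).2
  · refine (Real.prod_one_add_le_exp_sum _ fun _ => by positivity).trans ?_
    rw [← mul_sum, recipSum]

lemma omegaUpTo_le_omega (y : ℝ) (m : FreeMon P) : omegaUpTo N y m ≤ omega m :=
  card_filter_le _ _

/-- Exchange the sums: a generator p with y < N(p) ≤ x occurs in at most Cx/N(p) elements of the
ball. -/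
lemma sum_omega_sub_omegaUpTo_le (hG : LinearGrowth N c C) {x y : ℝ} (hx : 0 ≤ x) (hyx : y ≤ x) :
    ∑ m ∈ normBall N x, ((omega m : ℝ) - omegaUpTo N y m) ≤
      C * x * (hG.recipSum x - hG.recipSum y) := by
  classical
  have hsd : hG.recipSum x - hG.recipSum y = ∑ p ∈ hG.gens x \ hG.gens y, (N p : ℝ)⁻¹ := by
    rw [recipSum, recipSum, ← sum_sdiff (hG.gens_mono hyx)]
    ring
  rw [hsd, mul_sum]
  calc _ = ∑ m ∈ normBall N x, ∑ p ∈ hG.gens x \ hG.gens y with Finsupp.single p 1 ≤ m, (1 : ℝ) := by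
        refine sum_congr rfl fun m hm => ?_
        rw [sum_const, nsmul_eq_mul, mul_one, omega, omegaUpTo,
          ← card_filter_add_card_filter_not (s := m.support) (fun p => (N p : ℝ) ≤ y)]
        push_cast
        rw [add_sub_cancel_left]
        congr 2
        ext p
        simp only [mem_filter, mem_sdiff, hG.mem_gens, Finsupp.single_le_iff,
          Finsupp.mem_support_iff, Nat.one_le_iff_ne_zero]
        refine ⟨fun h => ⟨⟨?_, h.2⟩, h.1⟩, fun h => ⟨h.2, h.1.2⟩⟩
        exact hG.mem_gens.1 (hG.support_subset_gens hm (Finsupp.mem_support_iff.2 h.1))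
    _ = ∑ p ∈ hG.gens x \ hG.gens y, ∑ m ∈ normBall N x with Finsupp.single p 1 ≤ m, (1 : ℝ) := by
        simp_rw [sum_filter]
        exact sum_comm
    _ ≤ _ := by
        refine sum_le_sum fun p _ => ?_
        rw [sum_normBall_filter_le hG.one_lt hG.finite (fun _ => (1 : ℝ)), sum_const,
          nsmul_eq_mul, mul_one, normMap_single, pow_one, mul_assoc, ← div_eq_mul_inv]
        exact hG.card_le _ (by positivity)

/-- The error terms come, in order, from the counting error for small D, from the large D, from
replacing the product by an exponential, and from the generators above y. -/
lemma norm_sum_exp_omega_sub_le (hG : LinearGrowth N c C) {κ θ E x y ℓ : ℝ}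
    (hκ : 0 ≤ κ) (hθ : 0 ≤ θ) (hE : 0 ≤ E) (hx : 0 < x) (hy : 1 ≤ y) (hyx : y ≤ x)
    (hA : ∀ d : FreeMon P, |(#(normBall N (x / normMap N d)) : ℝ) - κ * (x / normMap N d)| ≤
      E * (x / normMap N d) ^ θ) {τ : ℝ} (hτ : |τ| ≤ 1) :
    ‖(x : ℂ)⁻¹ * ∑ m ∈ normBall N x, Complex.exp (Complex.I * (τ * omega m : ℝ)) -
        κ * Complex.exp ((Complex.exp (Complex.I * τ) - 1) * (hG.recipSum y : ℝ))‖ ≤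
      C * E * (y ^ ℓ * x ^ (θ - 1)) +
        (C + κ) * (2 ^ (-ℓ) * Real.exp (2 * (|τ| * hG.recipSum y))) +
        κ * (4 * C) * τ ^ 2 + C * (|τ| * (hG.recipSum x - hG.recipSum y)) := by
  have hC := hG.C_pos
  set z := Complex.exp (Complex.I * τ) - 1 with hz
  have hz1 : ‖z‖ ≤ |τ| := norm_exp_I_mul_sub_one_le τ
  have hS := hG.recipSum_nonneg y
  have h1 := hG.norm_sum_one_add_pow_omegaUpTo_sub_le (ℓ := ℓ) hκ hθ hE hx hy hA (hz1.trans hτ)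
  have h2 := norm_prod_one_add_sub_exp_le (hG.gens y) (fun p => (N p : ℝ)⁻¹) τ hτ
    (fun p _ => by positivity) (fun p _ => inv_le_one_of_one_le₀ (hG.one_lt_cast p).le)
  have h2' : ∑ p ∈ hG.gens y, ((N p : ℝ)⁻¹) ^ 2 ≤ 4 * C := by
    simpa only [inv_pow] using hG.sum_gen_inv_sq_le (hG.gens y)
  have hpow : ∀ m, (1 + z) ^ omegaUpTo N y m =
      Complex.exp (Complex.I * (τ * omegaUpTo N y m : ℝ)) := by
    intro m
    rw [hz, add_sub_cancel, ← Complex.exp_nat_mul]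
    congr 1
    push_cast
    ring
  have h3 : ‖∑ m ∈ normBall N x, Complex.exp (Complex.I * (τ * omega m : ℝ)) -
      ∑ m ∈ normBall N x, (1 + z) ^ omegaUpTo N y m‖ ≤
        |τ| * (C * x * (hG.recipSum x - hG.recipSum y)) := by
    rw [← sum_sub_distrib]
    calc _ ≤ ∑ m ∈ normBall N x, |τ| * ((omega m : ℝ) - omegaUpTo N y m) := by
          refine norm_sum_le_of_le _ fun m _ => ?_
          rw [hpow]
          refine (norm_exp_I_mul_sub_exp_I_mul_le _ _).trans (le_of_eq ?_)
          rw [← mul_sub, abs_mul, abs_of_nonneg (a := (omega m : ℝ) - _)]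
          exact sub_nonneg.2 (Nat.cast_le.2 (omegaUpTo_le_omega y m))
      _ ≤ _ := by
          rw [← mul_sum]
          gcongr
          exact hG.sum_omega_sub_omegaUpTo_le hx.le hyx
  set S₁ := ∑ m ∈ normBall N x, Complex.exp (Complex.I * (τ * omega m : ℝ))
  set S₂ := ∑ m ∈ normBall N x, (1 + z) ^ omegaUpTo N y m
  set T₁ := ∏ p ∈ hG.gens y, (1 + z * ((N p : ℝ)⁻¹ : ℝ))
  set W := Complex.exp (z * (hG.recipSum y : ℝ))
  have hxc : (x : ℂ) ≠ 0 := by exact_mod_cast hx.ne'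
  have hnx : ‖(x : ℂ)⁻¹‖ = x⁻¹ := by
    rw [norm_inv, Complex.norm_real, Real.norm_of_nonneg hx.le]
  have e : (x : ℂ)⁻¹ * S₁ - κ * W =
      (x : ℂ)⁻¹ * (S₂ - κ * x * T₁) + κ * (T₁ - W) + (x : ℂ)⁻¹ * (S₁ - S₂) := by
    field_simp
    ring
  rw [e]
  refine (norm_add₃_le).trans ?_
  rw [norm_mul, norm_mul, norm_mul, hnx, Complex.norm_real, Real.norm_of_nonneg hκ]
  have b1 : x⁻¹ * ‖S₂ - κ * x * T₁‖ ≤ C * E * (y ^ ℓ * x ^ (θ - 1)) +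
      (C + κ) * (2 ^ (-ℓ) * Real.exp (2 * (|τ| * hG.recipSum y))) := by
    calc _ ≤ x⁻¹ * (C * y ^ ℓ * (E * x ^ θ) +
          (C + κ) * x * 2 ^ (-ℓ) * Real.exp (2 * (|τ| * hG.recipSum y))) := by
          gcongr
          refine h1.trans ?_
          rw [mul_assoc 2 ‖z‖]
          gcongr
      _ = _ := by
          rw [Real.rpow_sub_one hx.ne']
          field_simp
  have b2 : κ * ‖T₁ - W‖ ≤ κ * (4 * C) * τ ^ 2 := by
    rw [mul_assoc]
    gcongr
    refine h2.trans ?_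
    rw [mul_comm]
    gcongr
  have b3 : x⁻¹ * ‖S₁ - S₂‖ ≤ C * (|τ| * (hG.recipSum x - hG.recipSum y)) := by
    calc _ ≤ x⁻¹ * (|τ| * (C * x * (hG.recipSum x - hG.recipSum y))) := by gcongr
      _ = _ := by field_simp
  linarith

end LinearGrowth
end ErdosKacMonoid
end

/-! ### Choice of the truncation and the Gaussian limit over all elements -/

noncomputable section
namespace ErdosKacMonoid
open Finset Filter Topology

/-- The logarithm of the truncation level: `log x / (log log x) ^ 2`. -/
def cutoff (x : ℝ) : ℝ := Real.exp (Real.log x / Real.log (Real.log x) ^ 2)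

lemma tendsto_loglog_atTop : Tendsto (fun x : ℝ => Real.log (Real.log x)) atTop atTop :=
  Real.tendsto_log_atTop.comp Real.tendsto_log_atTop

lemma eventually_exp_two_le_cutoff : ∀ᶠ x : ℝ in atTop, Real.exp 2 ≤ cutoff x := by
  have h := (Real.tendsto_exp_div_pow_atTop 2).comp tendsto_loglog_atTop
  filter_upwards [h.eventually_ge_atTop 2, Real.tendsto_log_atTop.eventually_gt_atTop 0]
    with x hx h1
  rw [cutoff, Real.exp_le_exp]
  simpa [Real.exp_log h1] using hx

lemma eventually_cutoff_le : ∀ᶠ x : ℝ in atTop, cutoff x ≤ x := by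
  filter_upwards [tendsto_loglog_atTop.eventually_ge_atTop 1, eventually_gt_atTop 0,
    Real.tendsto_log_atTop.eventually_gt_atTop 0] with x h1 h2 h3
  rw [cutoff, ← Real.le_log_iff_exp_le h2]
  exact div_le_self h3.le (one_le_pow₀ h1)

lemma eventually_loglog_cutoff : ∀ᶠ x : ℝ in atTop, Real.log (Real.log (cutoff x)) =
    Real.log (Real.log x) - 2 * Real.log (Real.log (Real.log x)) := by
  filter_upwards [tendsto_loglog_atTop.eventually_ge_atTop 1,
    Real.tendsto_log_atTop.eventually_gt_atTop 0] with x h1 h3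
  rw [cutoff, Real.log_exp, Real.log_div h3.ne' (by positivity), Real.log_pow]
  norm_num

/-- The first factor is exp(log x / log log x) = x^{o(1)}, which loses against x^(θ - 1). -/
lemma tendsto_cutoff_rpow_mul {θ : ℝ} (hθ : θ < 1) :
    Tendsto (fun x : ℝ => cutoff x ^ Real.log (Real.log x) * x ^ (θ - 1)) atTop (𝓝 0) := by
  have h : Tendsto (fun x : ℝ => x ^ (-((1 - θ) / 2))) atTop (𝓝 0) :=
    tendsto_rpow_neg_atTop (by linarith)
  refine squeeze_zero' ?_ ?_ h
  · filter_upwards [eventually_gt_atTop 0] with x hx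
    rw [cutoff]
    positivity
  · filter_upwards [eventually_gt_atTop 0, Real.tendsto_log_atTop.eventually_gt_atTop 0,
      tendsto_loglog_atTop.eventually_ge_atTop (2 / (1 - θ)),
      tendsto_loglog_atTop.eventually_gt_atTop 0] with x h0 h1 h2 h3
    rw [cutoff, ← Real.exp_mul, Real.rpow_def_of_pos h0, Real.rpow_def_of_pos h0, ← Real.exp_add,
      Real.exp_le_exp]
    have h4 : (Real.log (Real.log x))⁻¹ ≤ (1 - θ) / 2 := by
      rw [inv_le_comm₀ h3 (by linarith), inv_div]
      exact h2
    have h5 : Real.log x / Real.log (Real.log x) ^ 2 * Real.log (Real.log x) =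
        Real.log x * (Real.log (Real.log x))⁻¹ := by
      field_simp
    rw [h5]
    nlinarith

namespace LinearGrowth
variable {P : Type*} {N : P → ℕ} {c C : ℝ}

lemma exists_recipSum_cutoff_bounds (hG : LinearGrowth N c C) :
    ∃ B : ℝ, ∀ᶠ x : ℝ in atTop,
      |hG.recipSum (cutoff x) - Real.log (Real.log x)| ≤
        B + 2 * Real.log (Real.log (Real.log x)) ∧
      hG.recipSum x - hG.recipSum (cutoff x) ≤ B + 2 * Real.log (Real.log (Real.log x)) := by
  obtain ⟨B, hB⟩ := hG.exists_abs_recipSum_sub_le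
  refine ⟨2 * B, ?_⟩
  filter_upwards [eventually_exp_two_le_cutoff, eventually_cutoff_le, eventually_loglog_cutoff,
    tendsto_loglog_atTop.eventually_ge_atTop 1] with x h1 h2 h3 h4
  have hb1 := abs_le.1 (hB _ h1)
  have hb2 := abs_le.1 (hB _ (h1.trans h2))
  have h5 := Real.log_nonneg h4
  rw [h3] at hb1
  refine ⟨abs_le.2 ⟨?_, ?_⟩, ?_⟩ <;> linarith

/-- The centring `u` need only be log log of the level up to O(1), so that sums at level x/N(d) can
be centred at log log x. -/
lemma tendsto_charFun_normBall (hG : LinearGrowth N c C) {κ θ E : ℝ} (hκ : 0 ≤ κ) (hθ : 0 ≤ θ)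
    (hθ1 : θ < 1) (hE : 0 ≤ E) {α : Type*} {l : Filter α} {x u : α → ℝ} (hx : Tendsto x l atTop)
    (hA : ∀ᶠ a in l, ∀ d : FreeMon P,
      |(#(normBall N (x a / normMap N d)) : ℝ) - κ * (x a / normMap N d)| ≤
        E * (x a / normMap N d) ^ θ)
    {B : ℝ} (hu : ∀ᶠ a in l, |u a - Real.log (Real.log (x a))| ≤ B) (t : ℝ) :
    Tendsto (fun a => ((x a : ℝ) : ℂ)⁻¹ * ∑ m ∈ normBall N (x a),
        Complex.exp (Complex.I * (t * ((omega m - u a) / √(u a)) : ℝ))) l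
      (𝓝 (κ * Complex.exp (-t ^ 2 / 2))) := by
  obtain ⟨B₁, hB₁⟩ := hG.exists_recipSum_cutoff_bounds
  have hB₁ := hx.eventually hB₁
  have hl : Tendsto (fun a => Real.log (Real.log (x a))) l atTop := tendsto_loglog_atTop.comp hx
  have hut : Tendsto u l atTop := by
    refine tendsto_atTop_mono' l ?_ (tendsto_atTop_add_const_right l (-B) hl)
    filter_upwards [hu] with a ha
    linarith [(abs_le.1 ha).1]
  have hsq : Tendsto (fun a => √(u a)) l atTop := Real.tendsto_sqrt_atTop.comp hut
  have hsqinv : Tendsto (fun a => (√(u a))⁻¹) l (𝓝 0) := tendsto_inv_atTop_zero.comp hsq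
  set S := fun a => hG.recipSum (cutoff (x a))
  set S' := fun a => hG.recipSum (x a)
  -- Majorant, after division by √u, both of |S - u| and of the mass S' - S above the cutoff: log
  -- log log x ≤ log 2 + log u once log log x ≤ 2u.
  set G := fun a => (B + B₁ + 2 * Real.log 2 + 2 * Real.log (u a)) / √(u a) with hGdef
  have hG0 : Tendsto G l (𝓝 0) := by
    have h1 : Tendsto (fun v : ℝ => Real.log v / √v) atTop (𝓝 0) := by
      have := (isLittleO_log_rpow_atTop (r := 1 / 2) (by norm_num)).tendsto_div_nhds_zero
      simpa only [Real.sqrt_eq_rpow] using this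
    have h2 := (hsqinv.const_mul (B + B₁ + 2 * Real.log 2)).add ((h1.comp hut).const_mul 2)
    rw [mul_zero, mul_zero, add_zero] at h2
    refine h2.congr fun a => ?_
    simp only [Function.comp, hGdef]
    ring
  have hbounds : ∀ᶠ a in l, |S a - u a| ≤ B + B₁ + 2 * Real.log 2 + 2 * Real.log (u a) ∧
      S' a - S a ≤ B + B₁ + 2 * Real.log 2 + 2 * Real.log (u a) := by
    filter_upwards [hB₁, hu, hut.eventually_ge_atTop 1, hut.eventually_ge_atTop B,
      hl.eventually_gt_atTop 0] with a h1 h2 h3 h4 h5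
    have hle : Real.log (Real.log (x a)) ≤ 2 * u a := by linarith [(abs_le.1 h2).1]
    have hlog : Real.log (Real.log (Real.log (x a))) ≤ Real.log 2 + Real.log (u a) := by
      rw [← Real.log_mul (by norm_num) (by linarith)]
      exact Real.log_le_log h5 hle
    have hB0 : 0 ≤ B := (abs_nonneg _).trans h2
    have h2' := abs_le.1 h2
    have h1' := abs_le.1 h1.1
    refine ⟨abs_le.2 ⟨?_, ?_⟩, ?_⟩
    · linarith
    · linarith
    · linarith [h1.2]
  have hSu : Tendsto (fun a => (S a - u a) / √(u a)) l (𝓝 0) := by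
    refine squeeze_zero_norm' ?_ hG0
    filter_upwards [hbounds] with a ha
    rw [Real.norm_eq_abs, abs_div, abs_of_nonneg (Real.sqrt_nonneg _)]
    exact div_le_div_of_nonneg_right ha.1 (Real.sqrt_nonneg _)
  have hSS : Tendsto (fun a => (S' a - S a) / √(u a)) l (𝓝 0) := by
    refine squeeze_zero' ?_ ?_ hG0
    · filter_upwards [hx.eventually eventually_cutoff_le] with a ha
      exact div_nonneg (sub_nonneg.2 (hG.recipSum_mono ha)) (Real.sqrt_nonneg _)
    · filter_upwards [hbounds] with a ha
      simp only [hGdef]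
      gcongr
      exact ha.2
  have hratio : Tendsto (fun a => S a / u a) l (𝓝 1) := by
    have h := (hSu.mul hsqinv).add_const 1
    rw [zero_mul, zero_add] at h
    refine h.congr' ?_
    filter_upwards [hut.eventually_gt_atTop 0] with a ha
    have h1 : √(u a) * √(u a) = u a := Real.mul_self_sqrt ha.le
    have h2 : 0 < √(u a) := Real.sqrt_pos.2 ha
    rw [← div_eq_mul_inv, div_div, h1]
    field_simp
    ring
  set τ := fun a => t / √(u a) with hτ
  have hτ0 : Tendsto τ l (𝓝 0) := by
    simpa [hτ, div_eq_mul_inv] using hsqinv.const_mul t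
  have hτ1 : ∀ᶠ a in l, |τ a| ≤ 1 := by
    have := hτ0.abs
    rw [abs_zero] at this
    exact this.eventually_le_const one_pos
  have hτsq : ∀ᶠ a in l, τ a ^ 2 * S a = t ^ 2 * (S a / u a) := by
    filter_upwards [hut.eventually_gt_atTop 0] with a ha
    rw [hτ]
    simp only
    rw [div_pow, Real.sq_sqrt ha.le]
    ring
  have hτS : Tendsto (fun a => τ a ^ 2 * S a) l (𝓝 (t ^ 2)) := by
    have := hratio.const_mul (t ^ 2)
    rw [mul_one] at this
    exact this.congr' (hτsq.mono fun a ha => ha.symm)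
  have herr : Tendsto (fun a => C * E * (cutoff (x a) ^ Real.log (Real.log (x a)) * x a ^ (θ - 1)) +
        (C + κ) * (2 ^ (-Real.log (Real.log (x a))) * Real.exp (2 * (|τ a| * S a))) +
        κ * (4 * C) * τ a ^ 2 + C * (|τ a| * (S' a - S a))) l (𝓝 0) := by
    have e1 := ((tendsto_cutoff_rpow_mul hθ1).comp hx).const_mul (C * E)
    have e3 := (hτ0.pow 2).const_mul (κ * (4 * C))
    have e4 : Tendsto (fun a => C * (|τ a| * (S' a - S a))) l (𝓝 (C * (|t| * 0))) := by
      refine ((hSS.const_mul |t|).const_mul C).congr fun a => ?_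
      rw [hτ]
      simp only
      rw [abs_div, abs_of_nonneg (Real.sqrt_nonneg _)]
      ring
    have e2 : Tendsto (fun a => (C + κ) * (2 ^ (-Real.log (Real.log (x a))) *
        Real.exp (2 * (|τ a| * S a)))) l (𝓝 ((C + κ) * 0)) := by
      refine Tendsto.const_mul _ ?_
      -- The exponent of the Rankin term: 2|τ|S has order at most √u and is beaten by -u log 2.
      have hlim : Tendsto (fun a => √(u a) * (2 * |t| * (S a / u a) + √(u a) * (-Real.log 2)) +
          B * Real.log 2) l atBot := by
        refine tendsto_atBot_add_const_right _ _ (hsq.atTop_mul_atBot₀ ?_)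
        exact (hratio.const_mul (2 * |t|)).add_atBot
          (hsq.atTop_mul_const_of_neg (neg_lt_zero.2 (Real.log_pos one_lt_two)))
      refine squeeze_zero' (Eventually.of_forall fun a => by positivity) ?_
        (Real.tendsto_exp_atBot.comp hlim)
      filter_upwards [hu, hut.eventually_gt_atTop 0] with a h1 h2
      rw [Real.rpow_def_of_pos (by norm_num), ← Real.exp_add, Function.comp, Real.exp_le_exp]
      have h3 : √(u a) * √(u a) = u a := Real.mul_self_sqrt h2.le
      have h4 : 0 < √(u a) := Real.sqrt_pos.2 h2
      have h5 : |τ a| * S a = √(u a) * (|t| * (S a / u a)) := by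
        rw [hτ]
        simp only
        rw [abs_div, abs_of_nonneg h4.le]
        field_simp
        rw [sq, h3]
        ring
      have h6 : 0 < Real.log 2 := Real.log_pos one_lt_two
      have h7 : u a - B ≤ Real.log (Real.log (x a)) := by linarith [(abs_le.1 h1).2]
      have h8 := mul_le_mul_of_nonneg_left h7 h6.le
      rw [h5, mul_add, ← mul_assoc (√(u a)) (√(u a)), h3]
      linarith
    have := ((e1.add e2).add e3).add e4
    simpa using this
  have hdiff := squeeze_zero_norm' (f := fun a => ((x a : ℝ) : ℂ)⁻¹ * ∑ m ∈ normBall N (x a),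
      Complex.exp (Complex.I * (τ a * omega m : ℝ)) -
        κ * Complex.exp ((Complex.exp (Complex.I * τ a) - 1) * (S a : ℝ))) (by
    filter_upwards [hA, hx.eventually_gt_atTop 0, hx.eventually eventually_exp_two_le_cutoff,
      hx.eventually eventually_cutoff_le, hτ1] with a h1 h2 h3 h4 h5
    exact hG.norm_sum_exp_omega_sub_le hκ hθ hE h2
      ((Real.one_le_exp (by norm_num)).trans h3) h4 h1 h5) herr
  -- Write exp(iτ) - 1 = iτ - τ²/2 + O(|τ|³) and use τ(S - u) → 0, τ²S → t².
  have hmain : Tendsto (fun a => (Complex.exp (Complex.I * τ a) - 1) * (S a : ℝ) -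
      Complex.I * (τ a * u a : ℝ)) l (𝓝 (-t ^ 2 / 2)) := by
    have m1 : Tendsto (fun a => (Complex.exp (Complex.I * τ a) - 1 - Complex.I * τ a +
        τ a ^ 2 / 2) * (S a : ℝ)) l (𝓝 0) := by
      have hb : Tendsto (fun a => |τ a| * (τ a ^ 2 * S a)) l (𝓝 0) := by
        simpa using hτ0.abs.mul hτS
      refine squeeze_zero_norm' ?_ hb
      filter_upwards [hτ1] with a ha
      have hS0 : 0 ≤ S a := hG.recipSum_nonneg _
      rw [norm_mul, Complex.norm_real, Real.norm_of_nonneg hS0]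
      calc _ ≤ |τ a| ^ 3 * S a := by
            gcongr
            exact norm_exp_I_mul_sub_taylor_le ha
        _ = _ := by
            rw [← sq_abs (τ a)]
            ring
    have m2 : Tendsto (fun a => Complex.I * ((τ a * (S a - u a) : ℝ) : ℂ)) l (𝓝 0) := by
      have : Tendsto (fun a => τ a * (S a - u a)) l (𝓝 0) := by
        have := hSu.const_mul t
        rw [mul_zero] at this
        refine this.congr fun a => ?_
        rw [hτ]
        simp only
        ring
      have h2 := (Complex.continuous_ofReal.tendsto 0).comp this
      simpa using h2.const_mul Complex.I
    have m3 : Tendsto (fun a => ((-(τ a ^ 2 * S a) / 2 : ℝ) : ℂ)) l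
        (𝓝 ((-(t ^ 2) / 2 : ℝ) : ℂ)) :=
      (Complex.continuous_ofReal.tendsto _).comp (hτS.neg.div_const 2)
    have := (m1.add m2).add m3
    rw [zero_add, zero_add] at this
    push_cast at this
    refine this.congr fun a => ?_
    push_cast
    ring
  have hexp := (Complex.continuous_exp.tendsto _).comp hmain
  have hunit : ∀ a, ‖Complex.exp (-(Complex.I * (τ a * u a : ℝ)))‖ = 1 := fun a => by
    rw [← mul_neg, ← Complex.ofReal_neg, mul_comm, Complex.norm_exp_ofReal_mul_I]
  have hz : Tendsto (fun a => (((x a : ℝ) : ℂ)⁻¹ * ∑ m ∈ normBall N (x a),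
      Complex.exp (Complex.I * (τ a * omega m : ℝ)) -
        κ * Complex.exp ((Complex.exp (Complex.I * τ a) - 1) * (S a : ℝ))) *
        Complex.exp (-(Complex.I * (τ a * u a : ℝ)))) l (𝓝 0) := by
    rw [tendsto_zero_iff_norm_tendsto_zero] at hdiff ⊢
    simpa only [norm_mul, hunit, mul_one] using hdiff
  have hsum := hz.add (hexp.const_mul (κ : ℂ))
  rw [zero_add] at hsum
  refine hsum.congr fun a => ?_
  simp only [Function.comp]
  rw [sub_mul, mul_assoc (κ : ℂ), ← Complex.exp_add, ← sub_eq_add_neg, sub_add_cancel, mul_assoc,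
    sum_mul]
  congr 1
  refine sum_congr rfl fun m _ => ?_
  rw [← Complex.exp_add]
  congr 1
  rw [hτ]
  push_cast
  ring

end LinearGrowth
end ErdosKacMonoid
end

/-! ### Passage to h-free elements -/

noncomputable section
namespace ErdosKacMonoid
open Finset Filter Topology

variable {P : Type*} {N : P → ℕ} {c C : ℝ}

lemma omega_le_omega_add (d n : FreeMon P) : omega n ≤ omega (d + n) :=
  card_le_card (Finsupp.support_mono le_add_self)

lemma omega_multElem_add_le (k : ℕ) (D : Finset P) (n : FreeMon P) :
    omega (multElem k D + n) ≤ #D + omega n := by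
  classical
  refine (card_le_card Finsupp.support_add).trans ((card_union_le _ _).trans ?_)
  exact add_le_add (card_le_card (Finsupp.support_indicator_subset D fun _ _ => k)) le_rfl

open Classical in
/-- The finite set of the `h`-free elements of norm at most `t`, if finite. -/
def freeBall (N : P → ℕ) (h : ℕ) (t : ℝ) : Finset (FreeMon P) := {m ∈ normBall N t | IsFree h m}

/-- The density of the `h`-free elements among all elements. -/
def freeDensity (N : P → ℕ) (h : ℕ) : ℝ := ∑' D : Finset P, ∏ p ∈ D, (-((N p : ℝ) ^ h)⁻¹)

lemma exp_neg_two_mul_le {w : ℝ} (h0 : 0 ≤ w) (h1 : w ≤ 1 / 2) : Real.exp (-(2 * w)) ≤ 1 - w := by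
  have h2 : 1 + 2 * w ≤ Real.exp (2 * w) := by linarith [Real.add_one_le_exp (2 * w)]
  rw [Real.exp_neg, inv_le_iff_one_le_mul₀ (Real.exp_pos _)]
  nlinarith

namespace LinearGrowth

lemma inv_pow_le (hG : LinearGrowth N c C) {h : ℕ} (hh : 2 ≤ h) (p : P) :
    ((N p : ℝ) ^ h)⁻¹ ≤ ((N p : ℝ) ^ 2)⁻¹ := by
  have := hG.one_lt_cast p
  gcongr
  exact this.le

lemma summable_prod_inv_pow (hG : LinearGrowth N c C) {h : ℕ} (hh : 2 ≤ h) :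
    Summable fun D : Finset P => ∏ p ∈ D, ((N p : ℝ) ^ h)⁻¹ :=
  summable_finsetProd_of_summable_nonneg (fun _ => by positivity) <|
    hG.summable_gen_inv_sq.of_nonneg_of_le (fun _ => by positivity) (hG.inv_pow_le hh)

/-- The series is the Euler product of the factors 1 - N(p)^(-h). Since 1 - w ≥ exp(-2w) for w =
N(p)⁻² ≤ 1/2, every finite subproduct is at least exp(-8C). -/
lemma freeDensity_pos (hG : LinearGrowth N c C) {h : ℕ} (hh : 2 ≤ h) : 0 < freeDensity N h := by
  have hs : Summable fun D : Finset P => ∏ p ∈ D, (-((N p : ℝ) ^ h)⁻¹) := by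
    refine Summable.of_norm_bounded (hG.summable_prod_inv_pow hh) fun D => ?_
    rw [norm_prod]
    refine le_of_eq (prod_congr rfl fun p _ => ?_)
    rw [norm_neg, Real.norm_of_nonneg (by positivity)]
  have hp : HasProd (fun p => 1 + -((N p : ℝ) ^ h)⁻¹) (freeDensity N h) :=
    hasProd_one_add_of_hasSum_prod hs.hasSum
  refine lt_of_lt_of_le (Real.exp_pos (-(2 * (4 * C)))) (ge_of_tendsto' hp fun Q => ?_)
  calc Real.exp (-(2 * (4 * C))) ≤ Real.exp (∑ p ∈ Q, -(2 * ((N p : ℝ) ^ 2)⁻¹)) := by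
        rw [sum_neg_distrib, ← mul_sum, Real.exp_le_exp]
        linarith [hG.sum_gen_inv_sq_le Q]
    _ = ∏ p ∈ Q, Real.exp (-(2 * ((N p : ℝ) ^ 2)⁻¹)) := Real.exp_sum _ _
    _ ≤ _ := by
        refine prod_le_prod (fun _ _ => (Real.exp_pos _).le) fun p _ => ?_
        have h2 : (2 : ℝ) ≤ N p := by exact_mod_cast hG.one_lt p
        have h3 : ((N p : ℝ) ^ 2)⁻¹ ≤ 1 / 2 := by
          rw [one_div]
          gcongr
          nlinarith
        refine (exp_neg_two_mul_le (by positivity) h3).trans ?_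
        linarith [hG.inv_pow_le hh p]

lemma normBall_eq_empty (hG : LinearGrowth N c C) {t : ℝ} (ht : t < 1) : normBall N t = ∅ := by
  ext m
  simp only [hG.mem_normBall, notMem_empty, iff_false, not_le]
  exact ht.trans_le (one_le_normMap hG.one_lt m)

/-- Inclusion-exclusion: summing (-1)^|D| over the sets D of generators of multiplicity at least h
in m gives 1 if m is h-free and 0 otherwise. -/
lemma sum_freeBall (hG : LinearGrowth N c C) {h : ℕ} (hh : h ≠ 0) (x : ℝ) (F : FreeMon P → ℂ) :
    ∑ m ∈ freeBall N h x, F m = ∑' D : Finset P,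
      (-1) ^ #D * ∑ n ∈ normBall N (x / normMap N (multElem h D)), F (multElem h D + n) := by
  classical
  rw [tsum_eq_sum (s := (hG.gens x).powerset)]
  · calc ∑ m ∈ freeBall N h x, F m
        = ∑ m ∈ normBall N x, ∑ D ∈ (hG.gens x).powerset with multElem h D ≤ m,
            (-1) ^ #D * F m := by
          rw [freeBall, sum_filter]
          refine sum_congr rfl fun m hm => ?_
          have : (hG.gens x).powerset.filter (fun D => multElem h D ≤ m) =
              ({p ∈ m.support | h ≤ m p}).powerset := by
            ext D
            simp only [mem_filter, mem_powerset, multElem_le_iff, subset_iff]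
            refine ⟨fun H p hp => ⟨Finsupp.mem_support_iff.2 ?_, H.2 p hp⟩, fun H =>
              ⟨fun p hp => hG.support_subset_gens hm (H hp).1, fun p hp => (H hp).2⟩⟩
            have := H.2 p hp
            omega
          have hprod : ∑ D ∈ ({p ∈ m.support | h ≤ m p}).powerset, (-1 : ℂ) ^ #D =
              ∏ p ∈ m.support with h ≤ m p, (1 + (-1 : ℂ)) := by
            rw [prod_one_add]
            simp
          rw [this, ← sum_mul, hprod, add_neg_cancel, prod_const]
          by_cases hfree : IsFree h m
          · have : ({p ∈ m.support | h ≤ m p} : Finset P) = ∅ :=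
              filter_eq_empty_iff.2 fun p hp => not_le.2 (hfree p hp)
            rw [if_pos hfree, this, card_empty, pow_zero, one_mul]
          · rw [if_neg hfree, zero_pow, zero_mul]
            rw [IsFree] at hfree
            push Not at hfree
            obtain ⟨p, hp, hp'⟩ := hfree
            exact card_ne_zero_of_mem (mem_filter.2 ⟨hp, hp'⟩)
      _ = ∑ D ∈ (hG.gens x).powerset, ∑ m ∈ normBall N x with multElem h D ≤ m,
            (-1) ^ #D * F m := by
          simp_rw [sum_filter]
          exact sum_comm
      _ = _ := by
          refine sum_congr rfl fun D _ => ?_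
          rw [sum_normBall_filter_le hG.one_lt hG.finite (fun m => (-1) ^ #D * F m), mul_sum]
  -- If D contains a generator of norm above x, no multiple of hD has norm at most x, so the series
  -- is a finite sum.
  · intro D hD
    have : ∃ p ∈ D, x < N p := by
      by_contra! H
      exact hD (mem_powerset.2 fun p hp => hG.mem_gens.2 (H p hp))
    obtain ⟨p, hp, hxp⟩ := this
    have hle : N p ≤ normMap N (multElem h D) := by
      refine hG.le_normMap_of_mem_support (Finsupp.mem_support_iff.2 ?_)
      rwa [multElem_apply_of_mem hp]
    rw [hG.normBall_eq_empty, sum_empty, mul_zero]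
    have h0 : (0 : ℝ) < normMap N (multElem h D) := by exact_mod_cast normMap_pos hG.one_lt _
    rw [div_lt_one h0]
    exact hxp.trans_le (by exact_mod_cast hle)

end LinearGrowth

/-- Once x ≥ d², log(x/d) lies between (log x)/2 and log x. -/
lemma eventually_loglog_div_sub_le {d : ℝ} (hd : 1 ≤ d) : ∀ᶠ x : ℝ in atTop,
    |Real.log (Real.log x) - Real.log (Real.log (x / d))| ≤ Real.log 2 := by
  filter_upwards [eventually_ge_atTop (d ^ 2), eventually_gt_atTop 1] with x h1 h2
  have hd0 : 0 < d := by linarith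
  have hlx : 0 < Real.log x := Real.log_pos h2
  have h3 : 2 * Real.log d ≤ Real.log x := by
    have := Real.log_le_log (by positivity) h1
    rwa [Real.log_pow] at this
  have h4 : Real.log (x / d) = Real.log x - Real.log d :=
    Real.log_div (by linarith) (by linarith)
  have h5 : 0 ≤ Real.log d := Real.log_nonneg hd
  have h6 : Real.log x / 2 ≤ Real.log (x / d) := by linarith
  have h7 : Real.log (Real.log (x / d)) ≤ Real.log (Real.log x) :=
    Real.log_le_log (by linarith) (by linarith)
  have h8 := Real.log_le_log (by positivity) h6
  rw [Real.log_div (by linarith) (by norm_num)] at h8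
  rw [abs_of_nonneg (by linarith)]
  linarith

/-- The centred and normalised number of generators, with the parameters of the level `x`. -/
def normalizedOmega (x : ℝ) (m : FreeMon P) : ℝ :=
  (omega m - Real.log (Real.log x)) / √(Real.log (Real.log x))

lemma tendsto_cast_atTopIn (X : Set ℚ) : Tendsto (fun x : ℚ => (x : ℝ)) (atTopIn X) atTop :=
  tendsto_ratCast_atTop_iff.2 (tendsto_id.mono_left inf_le_left)

lemma eventually_mem_atTopIn (X : Set ℚ) : ∀ᶠ x in atTopIn X, x ∈ X :=
  mem_inf_of_right (mem_principal_self X)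

namespace LinearGrowth

/-- Adding kD changes ω by at most |D|, which is negligible after division by √(log log x). What
remains is the unshifted sum at level x/N(kD), all of whose quotients by norms stay in X. -/
lemma tendsto_charFun_shifted (hG : LinearGrowth N c C) {X : Set ℚ} (hX : IsRange N X)
    {κ θ E : ℝ} (hκ : 0 ≤ κ) (hθ : 0 ≤ θ) (hθ1 : θ < 1) (hE : 0 ≤ E)
    (hA : ∀ x ∈ X, 0 < x → |(#(normBall N x) : ℝ) - κ * x| ≤ E * (x : ℝ) ^ θ)
    (k : ℕ) (D : Finset P) (t : ℝ) :
    Tendsto (fun x : ℚ => ((x : ℝ) : ℂ)⁻¹ *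
      ∑ n ∈ normBall N (x / normMap N (multElem k D)),
        Complex.exp (Complex.I * (t * normalizedOmega x (multElem k D + n) : ℝ))) (atTopIn X)
      (𝓝 (κ * ((normMap N (multElem k D) : ℝ) : ℂ)⁻¹ * Complex.exp (-t ^ 2 / 2))) := by
  set d := multElem k D
  have hd1 : (1 : ℝ) ≤ normMap N d := one_le_normMap hG.one_lt d
  have hd0 : (0 : ℝ) < normMap N d := by linarith
  have hx := tendsto_cast_atTopIn X
  have hxd : Tendsto (fun x : ℚ => (x : ℝ) / normMap N d) (atTopIn X) atTop :=
    hx.atTop_div_const hd0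
  have hAd : ∀ᶠ x : ℚ in atTopIn X, ∀ e : FreeMon P,
      |(#(normBall N ((x : ℝ) / normMap N d / normMap N e)) : ℝ) -
        κ * ((x : ℝ) / normMap N d / normMap N e)| ≤
        E * ((x : ℝ) / normMap N d / normMap N e) ^ θ := by
    filter_upwards [eventually_mem_atTopIn X, hx.eventually_gt_atTop 0] with x hxX hx0 e
    have hpos : ∀ e : FreeMon P, (0 : ℚ) < normMap N e := fun e => by
      exact_mod_cast normMap_pos hG.one_lt e
    have hmem := hX.div_mem _ (hX.div_mem x hxX _ (hX.norm_mem d) (hpos d).ne') _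
      (hX.norm_mem e) (hpos e).ne'
    have h0 : (0 : ℚ) < x := by exact_mod_cast hx0
    have := hA _ hmem (div_pos (div_pos h0 (hpos d)) (hpos e))
    push_cast at this
    exact this
  have h1 := hG.tendsto_charFun_normBall hκ hθ hθ1 hE hxd hAd
    (u := fun x : ℚ => Real.log (Real.log x))
    (hx.eventually (eventually_loglog_div_sub_le hd1)) t
  have h2 := h1.const_mul (((normMap N d : ℝ) : ℂ)⁻¹)
  have hu : Tendsto (fun x : ℚ => √(Real.log (Real.log x))) (atTopIn X) atTop :=
    Real.tendsto_sqrt_atTop.comp (tendsto_loglog_atTop.comp hx)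
  have hb : Tendsto (fun x : ℚ => C * (|t| * #D) * (√(Real.log (Real.log x)))⁻¹) (atTopIn X)
      (𝓝 0) := by
    simpa using (tendsto_inv_atTop_zero.comp hu).const_mul (C * (|t| * #D))
  have h3 : Tendsto (fun x : ℚ => ((x : ℝ) : ℂ)⁻¹ * ∑ n ∈ normBall N (x / normMap N d),
      (Complex.exp (Complex.I * (t * normalizedOmega x (d + n) : ℝ)) -
        Complex.exp (Complex.I * (t * normalizedOmega x n : ℝ)))) (atTopIn X) (𝓝 0) := by
    refine squeeze_zero_norm' ?_ hb
    filter_upwards [hx.eventually_gt_atTop 0] with x hx0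
    have hterm : ∀ n ∈ normBall N (x / normMap N d),
        ‖Complex.exp (Complex.I * (t * normalizedOmega x (d + n) : ℝ)) -
          Complex.exp (Complex.I * (t * normalizedOmega x n : ℝ))‖ ≤
        |t| * #D * (√(Real.log (Real.log x)))⁻¹ := by
      intro n _
      refine (norm_exp_I_mul_sub_exp_I_mul_le _ _).trans ?_
      have e : t * normalizedOmega x (d + n) - t * normalizedOmega x n =
          t * ((omega (d + n) : ℝ) - omega n) * (√(Real.log (Real.log x)))⁻¹ := by
        rw [normalizedOmega, normalizedOmega]
        ring
      have h4 : (omega n : ℝ) ≤ omega (d + n) := by exact_mod_cast omega_le_omega_add d n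
      have h5 : (omega (d + n) : ℝ) ≤ #D + omega n := by
        exact_mod_cast omega_multElem_add_le k D n
      rw [e, abs_mul, abs_mul, abs_of_nonneg (a := (omega (d + n) : ℝ) - omega n) (by linarith),
        abs_of_nonneg (a := (√(Real.log (Real.log (x : ℝ))))⁻¹) (by positivity)]
      gcongr
      linarith
    have hcard := hG.card_le (x / normMap N d) (by positivity)
    have hle : (x : ℝ) / normMap N d ≤ x := div_le_self hx0.le hd1
    have hC := hG.C_pos
    rw [norm_mul, norm_inv, Complex.norm_real, Real.norm_of_nonneg hx0.le]
    calc _ ≤ (x : ℝ)⁻¹ * (#(normBall N (x / normMap N d)) •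
          (|t| * #D * (√(Real.log (Real.log x)))⁻¹)) := by
          gcongr
          refine (norm_sum_le_of_le _ hterm).trans (le_of_eq ?_)
          rw [sum_const]
      _ ≤ (x : ℝ)⁻¹ * ((C * x) * (|t| * #D * (√(Real.log (Real.log x)))⁻¹)) := by
          rw [nsmul_eq_mul]
          gcongr
          exact hcard.trans (by gcongr)
      _ = _ := by field_simp
  have h4 := h3.add h2
  rw [zero_add, ← mul_assoc, mul_comm _ (κ : ℂ)] at h4
  refine h4.congr' ?_
  filter_upwards [hx.eventually_gt_atTop 0] with x hx0
  have hdc : ((normMap N d : ℝ) : ℂ) ≠ 0 := by exact_mod_cast hd0.ne'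
  have hxc : ((x : ℝ) : ℂ) ≠ 0 := by exact_mod_cast hx0.ne'
  have e : (((normMap N d : ℝ) : ℂ))⁻¹ * ((((x : ℝ) / normMap N d : ℝ) : ℂ)⁻¹) =
      (((x : ℝ) : ℂ))⁻¹ := by
    rw [Complex.ofReal_div]
    field_simp
  rw [← mul_assoc, e, ← mul_add, sum_sub_distrib]
  simp only [normalizedOmega]
  rw [sub_add_cancel]

/-- Dominated convergence over D: the term of D is bounded by C/N(hD), uniformly in x > 0, and these
bounds are summable because h ≥ 2. -/
lemma tendsto_charFun_freeBall_mul (hG : LinearGrowth N c C) {X : Set ℚ} (hX : IsRange N X)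
    {κ θ E : ℝ} (hκ : 0 ≤ κ) (hθ : 0 ≤ θ) (hθ1 : θ < 1) (hE : 0 ≤ E)
    (hA : ∀ x ∈ X, 0 < x → |(#(normBall N x) : ℝ) - κ * x| ≤ E * (x : ℝ) ^ θ)
    {h : ℕ} (hh : 2 ≤ h) (t : ℝ) :
    Tendsto (fun x : ℚ => ((x : ℝ) : ℂ)⁻¹ * ∑ m ∈ freeBall N h x,
        Complex.exp (Complex.I * (t * normalizedOmega x m : ℝ))) (atTopIn X)
      (𝓝 ((κ * freeDensity N h : ℝ) * Complex.exp (-t ^ 2 / 2))) := by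
  have hx := tendsto_cast_atTopIn X
  have hlim := tendsto_tsum_of_dominated_convergence (𝓕 := atTopIn X)
    (f := fun (x : ℚ) (D : Finset P) => ((x : ℝ) : ℂ)⁻¹ * ((-1) ^ #D *
      ∑ n ∈ normBall N (x / normMap N (multElem h D)),
        Complex.exp (Complex.I * (t * normalizedOmega x (multElem h D + n) : ℝ))))
    (g := fun D => (-1) ^ #D *
      (κ * ((normMap N (multElem h D) : ℝ) : ℂ)⁻¹ * Complex.exp (-t ^ 2 / 2)))
    ((hG.summable_prod_inv_pow hh).mul_left C) (fun D => by
      refine ((hG.tendsto_charFun_shifted hX hκ hθ hθ1 hE hA h D t).const_mul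
        ((-1) ^ #D)).congr fun x => ?_
      ring) (by
      filter_upwards [hx.eventually_gt_atTop 0] with x hx0 D
      have hcard := hG.card_le (x / normMap N (multElem h D)) (by positivity)
      rw [norm_mul, norm_mul, norm_pow, norm_neg, norm_one, one_pow, one_mul, norm_inv,
        Complex.norm_real, Real.norm_of_nonneg hx0.le]
      calc _ ≤ (x : ℝ)⁻¹ * (C * (x / normMap N (multElem h D))) := by
            gcongr
            refine le_trans ?_ hcard
            refine (norm_sum_le_of_le _ fun n _ => le_of_eq ?_).trans
              (le_of_eq (b := ∑ n ∈ normBall N (x / normMap N (multElem h D)), (1 : ℝ)) rfl)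
              |>.trans (by simp)
            rw [mul_comm, Complex.norm_exp_ofReal_mul_I]
        _ = _ := by
            rw [normMap_multElem, prod_inv_distrib]
            push_cast
            field_simp)
  have hval : ∑' D : Finset P, (-1 : ℂ) ^ #D *
      (κ * ((normMap N (multElem h D) : ℝ) : ℂ)⁻¹ * Complex.exp (-t ^ 2 / 2)) =
      (κ * freeDensity N h : ℝ) * Complex.exp (-t ^ 2 / 2) := by
    rw [freeDensity, ← tsum_mul_left, Complex.ofReal_tsum, ← tsum_mul_right]
    refine tsum_congr fun D => ?_
    rw [normMap_multElem, prod_neg, prod_inv_distrib]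
    push_cast
    ring
  rw [hval] at hlim
  refine hlim.congr fun x => ?_
  rw [hG.sum_freeBall (by omega), tsum_mul_left]

lemma tendsto_card_freeBall_div (hG : LinearGrowth N c C) {X : Set ℚ} (hX : IsRange N X)
    {κ θ E : ℝ} (hκ : 0 ≤ κ) (hθ : 0 ≤ θ) (hθ1 : θ < 1) (hE : 0 ≤ E)
    (hA : ∀ x ∈ X, 0 < x → |(#(normBall N x) : ℝ) - κ * x| ≤ E * (x : ℝ) ^ θ)
    {h : ℕ} (hh : 2 ≤ h) :
    Tendsto (fun x : ℚ => (x : ℝ)⁻¹ * #(freeBall N h x)) (atTopIn X)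
      (𝓝 (κ * freeDensity N h)) := by
  have := hG.tendsto_charFun_freeBall_mul hX hκ hθ hθ1 hE hA hh 0
  have := (Complex.continuous_re.tendsto _).comp this
  convert this using 2 with x
  · simp [← Complex.ofReal_inv, -Complex.ofReal_ratCast]
  · simp

lemma tendsto_charFun_freeBall (hG : LinearGrowth N c C) {X : Set ℚ} (hX : IsRange N X)
    {κ θ E : ℝ} (hκ : 0 < κ) (hθ : 0 ≤ θ) (hθ1 : θ < 1) (hE : 0 ≤ E)
    (hA : ∀ x ∈ X, 0 < x → |(#(normBall N x) : ℝ) - κ * x| ≤ E * (x : ℝ) ^ θ)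
    {h : ℕ} (hh : 2 ≤ h) (t : ℝ) :
    Tendsto (fun x : ℚ => (#(freeBall N h x) : ℂ)⁻¹ * ∑ m ∈ freeBall N h x,
        Complex.exp (Complex.I * (t * normalizedOmega x m : ℝ))) (atTopIn X)
      (𝓝 (Complex.exp (-t ^ 2 / 2))) := by
  have hρ : 0 < κ * freeDensity N h := mul_pos hκ (hG.freeDensity_pos hh)
  have hρc : ((κ * freeDensity N h : ℝ) : ℂ) ≠ 0 := by exact_mod_cast hρ.ne'
  have h1 := hG.tendsto_charFun_freeBall_mul hX hκ.le hθ hθ1 hE hA hh t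
  have h2 := (Complex.continuous_ofReal.tendsto _).comp
    (hG.tendsto_card_freeBall_div hX hκ.le hθ hθ1 hE hA hh)
  have h3 := h1.div h2 hρc
  rw [mul_div_cancel_left₀ _ hρc] at h3
  refine h3.congr' ?_
  filter_upwards [(tendsto_cast_atTopIn X).eventually_gt_atTop 0] with x hx0
  have hxc : ((x : ℝ) : ℂ) ≠ 0 := by exact_mod_cast hx0.ne'
  simp only [Pi.div_apply, Function.comp]
  rw [Complex.ofReal_mul, Complex.ofReal_inv, Complex.ofReal_natCast,
    mul_div_mul_left _ _ (inv_ne_zero hxc), div_eq_inv_mul]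

end LinearGrowth
end ErdosKacMonoid
end

/-! ### From characteristic functions to distribution functions -/

noncomputable section
namespace ErdosKacMonoid
open Finset Filter Topology MeasureTheory ProbabilityTheory
open scoped ENNReal

lemma Phi_eq_add (a : ℝ) : Phi a = 1 / Real.sqrt (2 * Real.pi) *
    ((∫ u in Set.Iic (0 : ℝ), Real.exp (-u ^ 2 / 2)) + ∫ u in (0 : ℝ)..a, Real.exp (-u ^ 2 / 2)) := by
  have hint : Integrable fun u : ℝ => Real.exp (-u ^ 2 / 2) := by
    refine (integrable_exp_neg_mul_sq (b := 1 / 2) (by norm_num)).congr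
      (Eventually.of_forall fun u => ?_)
    simp only
    congr 1
    ring
  rw [Phi, ← intervalIntegral.integral_Iic_sub_Iic hint.integrableOn hint.integrableOn]
  congr 1
  ring

lemma continuous_Phi : Continuous Phi := by
  rw [show Phi = _ from funext Phi_eq_add]
  refine continuous_const.mul (continuous_const.add ?_)
  exact intervalIntegral.continuous_primitive
    (fun _ _ => Continuous.intervalIntegrable (by fun_prop) _ _) _

lemma gaussianReal_real_Iic (a : ℝ) : (gaussianReal 0 1).real (Set.Iic a) = Phi a := by
  rw [measureReal_def, gaussianReal_apply_eq_integral _ one_ne_zero,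
    ENNReal.toReal_ofReal (integral_nonneg fun _ => gaussianPDFReal_nonneg _ _ _), Phi,
    ← integral_const_mul]
  refine integral_congr_ae (Eventually.of_forall fun u => ?_)
  simp [gaussianPDFReal]

/-- The uniform distribution of the values of `Z` on the finite set `S`. -/
def empiricalMeasure {ι : Type*} (S : Finset ι) (Z : ι → ℝ) : Measure ℝ :=
  (#S : ℝ≥0∞)⁻¹ • ∑ m ∈ S, Measure.dirac (Z m)

lemma isProbabilityMeasure_empiricalMeasure {ι : Type*} {S : Finset ι} (hS : S.Nonempty)
    (Z : ι → ℝ) : IsProbabilityMeasure (empiricalMeasure S Z) := by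
  constructor
  simp only [empiricalMeasure, Measure.smul_apply, Measure.finsetSum_apply, measure_univ,
    sum_const, smul_eq_mul, nsmul_eq_mul, mul_one]
  exact ENNReal.inv_mul_cancel (by simpa using hS.ne_empty) (ENNReal.natCast_ne_top _)

lemma charFun_empiricalMeasure {ι : Type*} (S : Finset ι) (Z : ι → ℝ) (t : ℝ) :
    charFun (empiricalMeasure S Z) t =
      (#S : ℂ)⁻¹ * ∑ m ∈ S, Complex.exp (Complex.I * (t * Z m : ℝ)) := by
  rw [charFun_apply_real, empiricalMeasure, integral_smul_measure, integral_finsetSum_measure]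
  · simp only [integral_dirac, ENNReal.toReal_inv, ENNReal.toReal_natCast, Complex.real_smul]
    push_cast
    congr 1
    refine sum_congr rfl fun m _ => ?_
    congr 1
    ring
  · intro m _
    exact integrable_dirac (by simp)

lemma empiricalMeasure_real_Iic {ι : Type*} (S : Finset ι) (Z : ι → ℝ) (b : ℝ) :
    (empiricalMeasure S Z).real (Set.Iic b) = (#S : ℝ)⁻¹ * #{m ∈ S | Z m ≤ b} := by
  simp only [empiricalMeasure, measureReal_def, Measure.smul_apply, Measure.finsetSum_apply,
    Measure.dirac_apply, smul_eq_mul, ENNReal.toReal_mul, ENNReal.toReal_inv,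
    ENNReal.toReal_natCast]
  congr 1
  simp [Set.indicator_apply]

/-- Lévy's continuity theorem along sequences, which suffice as the filter is countably generated.
Half-lines are continuity sets because the Gaussian has no atoms. -/
lemma tendsto_card_filter_of_tendsto_charFun {α ι : Type*} {l : Filter α} [l.IsCountablyGenerated]
    {S : α → Finset ι} (hS : ∀ᶠ x in l, (S x).Nonempty) {Z : α → ι → ℝ}
    (h : ∀ t : ℝ, Tendsto (fun x => (#(S x) : ℂ)⁻¹ *
      ∑ m ∈ S x, Complex.exp (Complex.I * (t * Z x m : ℝ))) l (𝓝 (Complex.exp (-t ^ 2 / 2))))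
    (b : ℝ) : Tendsto (fun x => (#(S x) : ℝ)⁻¹ * #{m ∈ S x | Z x m ≤ b}) l (𝓝 (Phi b)) := by
  classical
  refine tendsto_of_seq_tendsto fun s hs => ?_
  -- The Dirac mass fills in for an empty set, which eventually does not occur.
  set μ : ℕ → ProbabilityMeasure ℝ := fun n =>
    if hn : (S (s n)).Nonempty then
      ⟨empiricalMeasure (S (s n)) (Z (s n)), isProbabilityMeasure_empiricalMeasure hn _⟩
    else ⟨Measure.dirac 0, inferInstance⟩ with hμ
  have hev : ∀ᶠ n in atTop, (μ n : Measure ℝ) = empiricalMeasure (S (s n)) (Z (s n)) := by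
    filter_upwards [hs.eventually hS] with n hn
    rw [show μ n = ⟨empiricalMeasure (S (s n)) (Z (s n)),
      isProbabilityMeasure_empiricalMeasure hn _⟩ from dif_pos hn]
    rfl
  set γ : ProbabilityMeasure ℝ := ⟨gaussianReal 0 1, inferInstance⟩
  have hconv : Tendsto μ atTop (𝓝 γ) := by
    refine ProbabilityMeasure.tendsto_of_tendsto_charFun fun t => ?_
    have hγ : charFun (γ : Measure ℝ) t = Complex.exp (-t ^ 2 / 2) := by
      change charFun (gaussianReal 0 1) t = _
      rw [charFun_gaussianReal]
      congr 1
      simp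
      ring
    rw [hγ]
    refine ((h t).comp hs).congr' ?_
    filter_upwards [hev] with n hn
    rw [hn, charFun_empiricalMeasure]
    rfl
  have hfront : (γ : Measure ℝ) (frontier (Set.Iic b)) = 0 := by
    rw [frontier_Iic]
    change gaussianReal 0 1 {b} = 0
    have := nullSingletonClass_gaussianReal (μ := 0) (v := 1) one_ne_zero
    exact measure_singleton b
  have hm := ProbabilityMeasure.tendsto_measure_of_null_frontier_of_tendsto' hconv hfront
  have hm' := (ENNReal.tendsto_toReal (measure_ne_top _ _)).comp hm
  rw [show ((γ : Measure ℝ) (Set.Iic b)).toReal = Phi b from gaussianReal_real_Iic b] at hm'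
  refine hm'.congr' ?_
  filter_upwards [hev] with n hn
  simp only [Function.comp]
  rw [hn]
  exact empiricalMeasure_real_Iic _ _ _

end ErdosKacMonoid
end

/-! ### Consequences of (⋆), and centring at the norm of the element -/

noncomputable section
namespace ErdosKacMonoid
open Finset Filter Topology

variable {P : Type*} {N : P → ℕ}

lemma eventually_atTopIn_iff {X : Set ℚ} {p : ℚ → Prop} :
    (∀ᶠ x in atTopIn X, p x) ↔ ∃ x₀ : ℚ, ∀ x ≥ x₀, x ∈ X → p x := by
  rw [atTopIn, eventually_inf_principal, eventually_atTop]

lemma exists_mem_ge_of_neBot {X : Set ℚ} [(atTopIn X).NeBot] (y : ℚ) : ∃ x ∈ X, y ≤ x := by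
  have h : ∀ᶠ x in atTopIn X, y ≤ x :=
    (tendsto_id.mono_left inf_le_left : Tendsto id (atTopIn X) atTop).eventually_ge_atTop y
  obtain ⟨x, h1, h2⟩ := (h.and (eventually_mem_atTopIn X)).exists
  exact ⟨x, h2, h1⟩

lemma setOf_cast_eq_elems (x : ℚ) :
    {m : FreeMon P | (normMap N m : ℝ) ≤ (x : ℝ)} = elems N x := by
  ext m
  simp only [elems, Set.mem_ofPred_eq]
  exact_mod_cast Iff.rfl

lemma card_normBall_of_finite (hf : ∀ t : ℝ, {m : FreeMon P | (normMap N m : ℝ) ≤ t}.Finite)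
    (x : ℚ) : #(normBall N x) = (elems N x).ncard := by
  rw [← setOf_cast_eq_elems, ← Set.ncard_coe_finset]
  congr 1
  ext m
  simp [mem_normBall_of_finite hf]

lemma card_normBall_mono (hf : ∀ t : ℝ, {m : FreeMon P | (normMap N m : ℝ) ≤ t}.Finite)
    {s t : ℝ} (hst : s ≤ t) : #(normBall N s) ≤ #(normBall N t) :=
  card_le_card fun m hm => by
    rw [mem_normBall_of_finite hf] at hm ⊢
    exact hm.trans hst

lemma one_le_card_normBall (hf : ∀ t : ℝ, {m : FreeMon P | (normMap N m : ℝ) ≤ t}.Finite)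
    {t : ℝ} (ht : 1 ≤ t) : 1 ≤ #(normBall N t) :=
  card_pos.2 ⟨0, by rw [mem_normBall_of_finite hf, normMap_zero]; exact_mod_cast ht⟩

lemma isLittleO_rpow_rpow_atTop {r s : ℝ} (h : r < s) :
    (fun x : ℝ => x ^ r) =o[atTop] fun x : ℝ => x ^ s := by
  refine Asymptotics.isLittleO_of_tendsto' ?_ ?_
  · filter_upwards [eventually_gt_atTop 0] with x hx h0
    exact absurd h0 (Real.rpow_pos_of_pos hx s).ne'
  · refine (tendsto_rpow_neg_atTop (sub_pos.2 h)).congr' ?_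
    filter_upwards [eventually_gt_atTop 0] with x hx
    rw [← Real.rpow_sub hx, neg_sub]

/-- The counting function along `X` is eventually between `κ x / 2` and `3 κ x / 2`. -/
lemma StarCondition.eventually_bounds {X : Set ℚ} {κ θ : ℝ} (hκ : 0 < κ) (hθ1 : θ < 1)
    (h : (fun x : ℚ => ((elems N x).ncard : ℝ) - κ * (x : ℝ)) =O[atTopIn X]
      (fun x : ℚ => (x : ℝ) ^ θ)) :
    ∀ᶠ x : ℚ in atTopIn X, κ / 2 * x ≤ (elems N x).ncard ∧
      ((elems N x).ncard : ℝ) ≤ 3 * κ / 2 * x := by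
  have h1 : (fun x : ℚ => (x : ℝ) ^ θ) =o[atTopIn X] (fun x : ℚ => (x : ℝ) ^ (1 : ℝ)) :=
    (isLittleO_rpow_rpow_atTop hθ1).comp_tendsto (tendsto_cast_atTopIn X)
  have h2 := (h.trans_isLittleO h1).bound (show 0 < κ / 2 by positivity)
  filter_upwards [h2, (tendsto_cast_atTopIn X).eventually_gt_atTop 0] with x hx hx0
  rw [Real.rpow_one, Real.norm_of_nonneg hx0.le, Real.norm_eq_abs, abs_le] at hx
  constructor <;> linarith

/-- The estimate is known only along X, but X contains the powers of a fixed norm q, and rounding t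
to such powers costs a bounded factor. A generator exists, since otherwise the monoid has one
element and the counts do not grow. -/
lemma exists_linearGrowth (hN : ∀ p, 1 < N p) {X : Set ℚ} (hX : IsRange N X)
    [(atTopIn X).NeBot] {κ : ℝ} (hκ : 0 < κ)
    (hb : ∀ᶠ x : ℚ in atTopIn X, κ / 2 * x ≤ (elems N x).ncard ∧
      ((elems N x).ncard : ℝ) ≤ 3 * κ / 2 * x) :
    ∃ c C : ℝ, LinearGrowth N c C := by
  obtain ⟨x₀, hx₀⟩ := eventually_atTopIn_iff.1 hb
  have hf : ∀ t : ℝ, {m : FreeMon P | (normMap N m : ℝ) ≤ t}.Finite := by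
    intro t
    obtain ⟨r, hr⟩ := exists_rat_gt t
    obtain ⟨x, hxX, hx⟩ := exists_mem_ge_of_neBot (X := X) (max x₀ (max r 1))
    have hx1 : (1 : ℝ) ≤ x := by
      exact_mod_cast (le_max_right r 1).trans ((le_max_right _ _).trans hx)
    have hxr : (r : ℝ) ≤ x := by exact_mod_cast (le_max_left r 1).trans ((le_max_right _ _).trans hx)
    have h1 := (hx₀ x ((le_max_left _ _).trans hx) hxX).1
    have h2 : (elems N x).ncard ≠ 0 := by
      intro h0
      rw [h0, Nat.cast_zero] at h1
      have : 0 < κ / 2 * x := by positivity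
      linarith
    rw [← setOf_cast_eq_elems] at h2
    exact (Set.finite_of_ncard_ne_zero h2).subset fun m hm => le_trans hm (hr.le.trans hxr)
  have hb' : ∀ x ≥ x₀, x ∈ X → κ / 2 * x ≤ #(normBall N x) ∧
      (#(normBall N x) : ℝ) ≤ 3 * κ / 2 * x := fun x h1 h2 => by
    rw [card_normBall_of_finite hf]
    exact hx₀ x h1 h2
  have hP : Nonempty P := by
    by_contra hP
    rw [not_nonempty_iff] at hP
    obtain ⟨r, hr⟩ := exists_rat_gt (2 / κ)
    obtain ⟨x, hxX, hx⟩ := exists_mem_ge_of_neBot (X := X) (max x₀ r)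
    have h1 := (hb' x ((le_max_left _ _).trans hx) hxX).1
    have h2 : #(normBall N (x : ℝ)) ≤ 1 := card_le_one.2 fun m _ n _ => Subsingleton.elim m n
    have h3 : (#(normBall N (x : ℝ)) : ℝ) ≤ 1 := by exact_mod_cast h2
    have h4 : (r : ℝ) ≤ x := by exact_mod_cast (le_max_right _ _).trans hx
    have h5 : 2 / κ < x := hr.trans_le h4
    rw [div_lt_iff₀ hκ] at h5
    linarith
  obtain ⟨p₀⟩ := hP
  set q := N p₀ with hq
  have hq1 : (1 : ℝ) < q := by exact_mod_cast hN p₀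
  have hq0 : (0 : ℝ) < q := by linarith
  have hmem : ∀ k : ℕ, ((q ^ k : ℕ) : ℚ) ∈ X := fun k => by
    have := hX.norm_mem (Finsupp.single p₀ k)
    rwa [normMap_single] at this
  obtain ⟨k₁, hk₁⟩ := pow_unbounded_of_one_lt (x₀ : ℝ) hq1
  have hbq : ∀ k, k₁ ≤ k → κ / 2 * (q : ℝ) ^ k ≤ #(normBall N ((q : ℝ) ^ k)) ∧
      (#(normBall N ((q : ℝ) ^ k)) : ℝ) ≤ 3 * κ / 2 * (q : ℝ) ^ k := fun k hk => by
    have h1 : (x₀ : ℝ) ≤ (q : ℝ) ^ k := hk₁.le.trans (pow_le_pow_right₀ hq1.le hk)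
    have := hb' ((q ^ k : ℕ) : ℚ) (by exact_mod_cast h1) (hmem k)
    push_cast at this
    exact this
  -- In the lower constant, κ/(2q) serves for t ≥ q^k₁; below that, the zero element alone gives 1 ≥
  -- t/q^k₁. In the upper constant, the extra q^k₁ pushes the power above t into the range of the
  -- estimate.
  refine ⟨min (κ / (2 * q)) ((q : ℝ) ^ k₁)⁻¹, 3 * κ / 2 * q ^ (k₁ + 1), hN, by positivity, hf,
    fun t ht => ?_, fun t ht => ?_⟩
  · obtain ⟨k, hk1, hk2⟩ := exists_nat_pow_near ht hq1
    rcases le_or_gt k₁ k with hk | hk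
    · calc _ ≤ κ / (2 * q) * t := by gcongr; exact min_le_left _ _
        _ ≤ κ / (2 * q) * (q : ℝ) ^ (k + 1) := by gcongr
        _ = κ / 2 * (q : ℝ) ^ k := by
          rw [pow_succ]
          field_simp
        _ ≤ #(normBall N ((q : ℝ) ^ k)) := (hbq k hk).1
        _ ≤ _ := by exact_mod_cast card_normBall_mono hf hk1
    · calc _ ≤ ((q : ℝ) ^ k₁)⁻¹ * t := by gcongr; exact min_le_right _ _
        _ ≤ ((q : ℝ) ^ k₁)⁻¹ * (q : ℝ) ^ k₁ := by
          gcongr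
          exact hk2.le.trans (pow_le_pow_right₀ hq1.le hk)
        _ = 1 := inv_mul_cancel₀ (by positivity)
        _ ≤ _ := by exact_mod_cast one_le_card_normBall hf ht
  · rcases lt_or_ge t 1 with h1 | h1
    · have : normBall N t = ∅ := by
        ext m
        simp only [mem_normBall_of_finite hf, notMem_empty, iff_false, not_le]
        exact h1.trans_le (one_le_normMap hN m)
      rw [this, card_empty, Nat.cast_zero]
      positivity
    · obtain ⟨k, hk1, hk2⟩ := exists_nat_pow_near h1 hq1
      calc (#(normBall N t) : ℝ) ≤ #(normBall N ((q : ℝ) ^ (k + 1 + k₁))) := by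
            refine Nat.cast_le.2 (card_normBall_mono hf (hk2.le.trans ?_))
            exact pow_le_pow_right₀ hq1.le (by omega)
        _ ≤ 3 * κ / 2 * (q : ℝ) ^ (k + 1 + k₁) := (hbq _ (by omega)).2
        _ = 3 * κ / 2 * q ^ (k₁ + 1) * (q : ℝ) ^ k := by ring
        _ ≤ _ := by gcongr

/-- The levels x/N(d) can be arbitrarily small, so (⋆) is needed at every positive point of X. Below
1 the ball is empty and κx ≤ κx^θ; between 1 and x₀ the trivial bound suffices. -/
lemma LinearGrowth.exists_abs_card_sub_le {c C : ℝ} (hG : LinearGrowth N c C) {X : Set ℚ}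
    {κ θ : ℝ} (hκ : 0 < κ) (hθ : 0 ≤ θ) (hθ1 : θ < 1)
    (h : (fun x : ℚ => ((elems N x).ncard : ℝ) - κ * (x : ℝ)) =O[atTopIn X]
      (fun x : ℚ => (x : ℝ) ^ θ)) :
    ∃ E, 0 ≤ E ∧ ∀ x ∈ X, 0 < x → |(#(normBall N x) : ℝ) - κ * x| ≤ E * (x : ℝ) ^ θ := by
  obtain ⟨E, hE, hb⟩ := h.exists_nonneg
  obtain ⟨x₀, hx₀⟩ := eventually_atTopIn_iff.1 hb.bound
  have hC := hG.C_pos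
  refine ⟨E + κ + (C + κ) * |(x₀ : ℝ)|, by positivity, fun x hxX hx0 => ?_⟩
  have hx0' : (0 : ℝ) < x := by exact_mod_cast hx0
  have hpow : 0 < (x : ℝ) ^ θ := Real.rpow_pos_of_pos hx0' θ
  have a1 : 0 ≤ E * (x : ℝ) ^ θ := by positivity
  have a2 : 0 ≤ κ * (x : ℝ) ^ θ := by positivity
  have a3 : 0 ≤ (C + κ) * |(x₀ : ℝ)| * (x : ℝ) ^ θ := by positivity
  rw [add_mul, add_mul]
  rcases le_or_gt x₀ x with h1 | h1
  · have := hx₀ x h1 hxX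
    rw [Real.norm_eq_abs, Real.norm_of_nonneg hpow.le, ← card_normBall_of_finite hG.finite] at this
    linarith
  · rcases lt_or_ge (x : ℝ) 1 with h2 | h2
    · rw [hG.normBall_eq_empty h2, card_empty, Nat.cast_zero, zero_sub, abs_neg,
        abs_of_pos (by positivity)]
      have : (x : ℝ) ≤ (x : ℝ) ^ θ := by
        simpa using Real.rpow_le_rpow_of_exponent_ge hx0' h2.le hθ1.le
      have := mul_le_mul_of_nonneg_left this hκ.le
      linarith
    · have h3 : (1 : ℝ) ≤ (x : ℝ) ^ θ := Real.one_le_rpow h2 hθ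
      have h4 : (x : ℝ) ≤ |(x₀ : ℝ)| := le_trans (by exact_mod_cast h1.le) (le_abs_self _)
      have h5 := hG.card_le x hx0'.le
      have h6 : |(#(normBall N x) : ℝ) - κ * x| ≤ (C + κ) * x := by
        have : 0 ≤ κ * x := by positivity
        have : 0 ≤ C * x := by positivity
        rw [abs_le, add_mul]
        constructor <;> linarith [Nat.cast_nonneg (α := ℝ) #(normBall N (x : ℝ))]
      calc _ ≤ (C + κ) * x := h6
        _ ≤ (C + κ) * |(x₀ : ℝ)| * 1 := by
          rw [mul_one]
          gcongr
        _ ≤ (C + κ) * |(x₀ : ℝ)| * (x : ℝ) ^ θ := by gcongr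
        _ ≤ _ := by linarith

/-- The Gaussian threshold at the norm of `m` and the one at the level `x`. -/
lemma eventually_abs_threshold_sub_le (a : ℝ) {ε : ℝ} (hε : 0 < ε) : ∀ᶠ x : ℝ in atTop,
    ∀ n : ℝ, √x ≤ n → n ≤ x →
      0 < Real.log (Real.log n) ∧
      |(Real.log (Real.log n) + a * √(Real.log (Real.log n))) -
        (Real.log (Real.log x) + a * √(Real.log (Real.log x)))| ≤ ε * √(Real.log (Real.log x)) := by
  have hsq : Tendsto (fun x : ℝ => √(Real.log (Real.log x))) atTop atTop :=
    Real.tendsto_sqrt_atTop.comp tendsto_loglog_atTop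
  filter_upwards [eventually_gt_atTop 1, tendsto_loglog_atTop.eventually_ge_atTop 2,
    hsq.eventually_ge_atTop ((1 + |a|) / ε), Real.tendsto_log_atTop.eventually_gt_atTop 0]
    with x h1 h2 h3 h4 n hn1 hn2
  have hx0 : 0 < x := by linarith
  have hs0 : 0 < √x := Real.sqrt_pos.2 hx0
  have hlog : Real.log x / 2 ≤ Real.log n := by
    rw [← Real.log_sqrt hx0.le]
    exact Real.log_le_log hs0 hn1
  have hlog2 : Real.log n ≤ Real.log x := Real.log_le_log (hs0.trans_le hn1) hn2
  set u := Real.log (Real.log x)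
  set v := Real.log (Real.log n)
  have hvu : v ≤ u := Real.log_le_log (by linarith) hlog2
  -- From log n ≥ (log x)/2 the loss is log 2 < 1.
  have huv : u - 1 ≤ v := by
    have := Real.log_le_log (by positivity) hlog
    rw [Real.log_div h4.ne' (by norm_num)] at this
    have h5 := Real.log_two_lt_d9
    linarith
  have hv1 : 1 ≤ v := by linarith
  have hsv : √v ≤ √u := Real.sqrt_le_sqrt hvu
  have hsu : √u ≤ √v + 1 := by
    have : u ≤ (√v + 1) ^ 2 := by
      have := Real.sq_sqrt (show 0 ≤ v by linarith)
      nlinarith [Real.sqrt_nonneg v]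
    exact Real.sqrt_le_iff.2 ⟨by positivity, this⟩
  refine ⟨by linarith, ?_⟩
  have e : (v + a * √v) - (u + a * √u) = (v - u) + a * (√v - √u) := by ring
  rw [e]
  calc _ ≤ |v - u| + |a * (√v - √u)| := abs_add_le _ _
    _ ≤ 1 + |a| * 1 := by
        rw [abs_mul]
        gcongr
        · exact abs_le.2 ⟨by linarith, by linarith⟩
        · exact abs_le.2 ⟨by linarith, by linarith⟩
    _ ≤ _ := by
        rw [div_le_iff₀ hε] at h3
        linarith

namespace LinearGrowth
variable {c C : ℝ}

lemma mem_freeBall (hG : LinearGrowth N c C) {h : ℕ} {t : ℝ} {m : FreeMon P} :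
    m ∈ freeBall N h t ↔ (normMap N m : ℝ) ≤ t ∧ IsFree h m := by
  simp [freeBall, hG.mem_normBall]

lemma coe_freeBall (hG : LinearGrowth N c C) (h : ℕ) (x : ℚ) :
    (freeBall N h (x : ℝ) : Set (FreeMon P)) = freeElems N h x := by
  ext m
  simp only [mem_coe, hG.mem_freeBall, freeElems, Set.mem_ofPred_eq, and_comm (a := IsFree h m)]
  exact_mod_cast Iff.rfl

open Classical in
/-- The `h`-free elements of norm at most `x` whose own normalised number of generators is at
most `a`. -/
def lowFree (N : P → ℕ) (h : ℕ) (a : ℝ) (x : ℝ) : Finset (FreeMon P) :=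
  {m ∈ freeBall N h x | 3 ≤ normMap N m ∧
    ((omega m : ℝ) - Real.log (Real.log (normMap N m : ℝ))) /
      Real.sqrt (Real.log (Real.log (normMap N m : ℝ))) ≤ a}

/-- Above norm √x the two thresholds differ by at most ε√(log log x), so moving a by ε absorbs the
change of centring. The elements of norm at most √x are at most C√x in number. -/
lemma eventually_card_lowFree_bounds (hG : LinearGrowth N c C) (h : ℕ) (a : ℝ) {ε : ℝ}
    (hε : 0 < ε) : ∀ᶠ x : ℝ in atTop,
      (#(lowFree N h a x) : ℝ) ≤
        #{m ∈ freeBall N h x | normalizedOmega x m ≤ a + ε} + C * √x ∧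
      (#{m ∈ freeBall N h x | normalizedOmega x m ≤ a - ε} : ℝ) ≤
        #(lowFree N h a x) + C * √x := by
  classical
  have hsqrt : Tendsto (fun x : ℝ => √x) atTop atTop := Real.tendsto_sqrt_atTop
  filter_upwards [eventually_abs_threshold_sub_le a hε, hsqrt.eventually_ge_atTop 3,
    tendsto_loglog_atTop.eventually_gt_atTop 0] with x h1 h2 h3
  have hcard : (#(normBall N √x) : ℝ) ≤ C * √x := hG.card_le _ (Real.sqrt_nonneg x)
  have hsu : 0 < √(Real.log (Real.log x)) := Real.sqrt_pos.2 h3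
  constructor
  · refine le_trans ?_ (add_le_add_right hcard _)
    have : lowFree N h a x ⊆
        {m ∈ freeBall N h x | normalizedOmega x m ≤ a + ε} ∪ normBall N √x := by
      intro m hm
      obtain ⟨hm1, -, hm3⟩ := mem_filter.1 hm
      rw [mem_union, mem_filter, hG.mem_normBall]
      rcases le_or_gt (normMap N m : ℝ) √x with hle | hlt
      · exact Or.inr hle
      · refine Or.inl ⟨hm1, ?_⟩
        obtain ⟨hv, hab⟩ := h1 _ hlt.le (hG.mem_freeBall.1 hm1).1
        rw [div_le_iff₀ (Real.sqrt_pos.2 hv)] at hm3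
        rw [normalizedOmega, div_le_iff₀ hsu]
        linarith [(abs_le.1 hab).2]
    exact_mod_cast (card_le_card this).trans (card_union_le _ _)
  · refine le_trans ?_ (add_le_add_right hcard _)
    have : {m ∈ freeBall N h x | normalizedOmega x m ≤ a - ε} ⊆
        lowFree N h a x ∪ normBall N √x := by
      intro m hm
      obtain ⟨hm1, hm3⟩ := mem_filter.1 hm
      rw [mem_union, lowFree, mem_filter, hG.mem_normBall]
      rcases le_or_gt (normMap N m : ℝ) √x with hle | hlt
      · exact Or.inr hle
      · refine Or.inl ⟨hm1, ?_, ?_⟩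
        · exact_mod_cast h2.trans hlt.le
        · obtain ⟨hv, hab⟩ := h1 _ hlt.le (hG.mem_freeBall.1 hm1).1
          rw [normalizedOmega, div_le_iff₀ hsu] at hm3
          rw [div_le_iff₀ (Real.sqrt_pos.2 hv)]
          linarith [(abs_le.1 hab).1]
    exact_mod_cast (card_le_card this).trans (card_union_le _ _)

end LinearGrowth

/-- A function squeezed between `g (a - ε) - r` and `g (a + ε) + r` for every `ε`. -/
lemma tendsto_of_forall_sandwich {α : Type*} {l : Filter α} {f r : α → ℝ} {g : ℝ → α → ℝ}
    {Ψ : ℝ → ℝ} {a : ℝ} (hΨ : ContinuousAt Ψ a) (hg : ∀ b, Tendsto (g b) l (𝓝 (Ψ b)))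
    (hr : Tendsto r l (𝓝 0))
    (h : ∀ ε > 0, ∀ᶠ x in l, f x ≤ g (a + ε) x + r x ∧ g (a - ε) x - r x ≤ f x) :
    Tendsto f l (𝓝 (Ψ a)) := by
  rw [tendsto_order]
  constructor
  · intro b hb
    have h1 : ∀ᶠ ε : ℝ in 𝓝[>] 0, b < Ψ (a - ε) := by
      have : Tendsto (fun ε : ℝ => Ψ (a - ε)) (𝓝[>] 0) (𝓝 (Ψ a)) := by
        refine hΨ.tendsto.comp (tendsto_nhdsWithin_of_tendsto_nhds ?_)
        exact Continuous.tendsto' (by fun_prop) _ _ (by simp)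
      exact this.eventually_const_lt hb
    obtain ⟨ε, hε1, hε2⟩ := (h1.and self_mem_nhdsWithin).exists
    have h2 := (hg (a - ε)).sub hr
    rw [sub_zero] at h2
    filter_upwards [h ε hε2, h2.eventually_const_lt hε1] with x hx1 hx2
    exact hx2.trans_le hx1.2
  · intro b hb
    have h1 : ∀ᶠ ε : ℝ in 𝓝[>] 0, Ψ (a + ε) < b := by
      have : Tendsto (fun ε : ℝ => Ψ (a + ε)) (𝓝[>] 0) (𝓝 (Ψ a)) := by
        refine hΨ.tendsto.comp (tendsto_nhdsWithin_of_tendsto_nhds ?_)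
        exact Continuous.tendsto' (by fun_prop) _ _ (by simp)
      exact this.eventually_lt_const hb
    obtain ⟨ε, hε1, hε2⟩ := (h1.and self_mem_nhdsWithin).exists
    have h2 := (hg (a + ε)).add hr
    rw [add_zero] at h2
    filter_upwards [h ε hε2, h2.eventually_lt_const hε1] with x hx1 hx2
    exact hx1.1.trans_lt hx2

instance (X : Set ℚ) : (atTopIn X).IsCountablyGenerated := by
  unfold atTopIn
  infer_instance

end ErdosKacMonoid
end

/-! ### The final deduction -/

theorem theorem1p3 {P : Type*} [Countable P] (N : P → ℕ) (hN : ∀ p, 1 < N p)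
    (X : Set ℚ) (hX : ErdosKacMonoid.IsRange N X)
    (hstar : ErdosKacMonoid.StarCondition N X)
    (h : ℕ) (hh : 2 ≤ h) (a : ℝ) :
    Filter.Tendsto
      (fun x : ℚ =>
        1 / ((ErdosKacMonoid.freeElems N h x).ncard : ℝ) *
          ({m ∈ ErdosKacMonoid.freeElems N h x |
              3 ≤ ErdosKacMonoid.normMap N m ∧
              ((ErdosKacMonoid.omega m : ℝ) -
                  Real.log (Real.log (ErdosKacMonoid.normMap N m : ℝ))) /
                Real.sqrt (Real.log (Real.log (ErdosKacMonoid.normMap N m : ℝ))) ≤ a}.ncard : ℝ))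
      (ErdosKacMonoid.atTopIn X) (nhds (ErdosKacMonoid.Phi a)) := by
  classical
  -- X may be bounded above, for instance {1} when there are no generators; the limit is then
  -- vacuous.
  rcases Filter.eq_or_neBot (ErdosKacMonoid.atTopIn X) with hbot | hne
  · rw [hbot]
    exact Filter.tendsto_bot
  obtain ⟨κ, θ, hκ, hθ, hθ1, hO⟩ := hstar
  obtain ⟨c, C, hG⟩ := ErdosKacMonoid.exists_linearGrowth hN hX hκ
    (ErdosKacMonoid.StarCondition.eventually_bounds hκ hθ1 hO)
  obtain ⟨E, hE, hA⟩ := hG.exists_abs_card_sub_le hκ hθ hθ1 hO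
  have hx := ErdosKacMonoid.tendsto_cast_atTopIn X
  have hρ : 0 < κ * ErdosKacMonoid.freeDensity N h := mul_pos hκ (hG.freeDensity_pos hh)
  have hcard := hG.tendsto_card_freeBall_div hX hκ.le hθ hθ1 hE hA hh
  have hpos : ∀ᶠ x : ℚ in ErdosKacMonoid.atTopIn X,
      (0 : ℝ) < (ErdosKacMonoid.freeBall N h (x : ℝ)).card := by
    filter_upwards [hcard.eventually_const_lt hρ, hx.eventually_gt_atTop 0] with x h1 h2
    exact (mul_pos_iff_of_pos_left (inv_pos.2 h2)).1 h1
  have hg := ErdosKacMonoid.tendsto_card_filter_of_tendsto_charFun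
    (hpos.mono fun x hx => Finset.card_pos.1 (by exact_mod_cast hx))
    (hG.tendsto_charFun_freeBall hX hκ hθ hθ1 hE hA hh)
  have hr : Filter.Tendsto (fun x : ℚ =>
      ((ErdosKacMonoid.freeBall N h (x : ℝ)).card : ℝ)⁻¹ * (C * √(x : ℝ)))
      (ErdosKacMonoid.atTopIn X) (nhds 0) := by
    have h1 : Filter.Tendsto (fun x : ℚ => C * (√(x : ℝ))⁻¹)
        (ErdosKacMonoid.atTopIn X) (nhds 0) := by
      simpa using (tendsto_inv_atTop_zero.comp (Real.tendsto_sqrt_atTop.comp hx)).const_mul C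
    have h2 := (hcard.inv₀ hρ.ne').mul h1
    rw [mul_zero] at h2
    refine h2.congr' ?_
    filter_upwards [hx.eventually_gt_atTop 0] with x hx0
    have h3 : √(x : ℝ) * √(x : ℝ) = x := Real.mul_self_sqrt hx0.le
    have h4 : 0 < √(x : ℝ) := Real.sqrt_pos.2 hx0
    rw [mul_inv, inv_inv]
    nth_rewrite 1 [← h3]
    field_simp
  refine ErdosKacMonoid.tendsto_of_forall_sandwich
    ErdosKacMonoid.continuous_Phi.continuousAt hg hr fun ε hε => ?_
  filter_upwards [hx.eventually (hG.eventually_card_lowFree_bounds h a hε)] with x hb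
  have e1 : (ErdosKacMonoid.freeElems N h x).ncard =
      (ErdosKacMonoid.freeBall N h (x : ℝ)).card := by
    rw [← hG.coe_freeBall, Set.ncard_coe_finset]
  have e2 : {m ∈ ErdosKacMonoid.freeElems N h x |
              3 ≤ ErdosKacMonoid.normMap N m ∧
              ((ErdosKacMonoid.omega m : ℝ) -
                  Real.log (Real.log (ErdosKacMonoid.normMap N m : ℝ))) /
                Real.sqrt (Real.log (Real.log (ErdosKacMonoid.normMap N m : ℝ))) ≤ a}.ncard =
      (ErdosKacMonoid.LinearGrowth.lowFree N h a x).card := by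
    rw [← hG.coe_freeBall, ← Set.ncard_coe_finset, ErdosKacMonoid.LinearGrowth.lowFree,
      Finset.coe_filter]
    rfl
  rw [e1, e2, one_div, ← mul_add, ← mul_sub]
  refine ⟨mul_le_mul_of_nonneg_left hb.1 (by positivity),
    mul_le_mul_of_nonneg_left ?_ (by positivity)⟩
  linarith [hb.2]
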